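/- Let $n\ge 2$ and $\epsilon\in\{1,-1\}$. On $\mathbb R^{n+2}$ put $\langle x,y\rangle_\epsilon=x_0y_0+\epsilon\sum_{i=1}^{n+1}x_iy_i$, and let $\mathbb M_\epsilon=\{x:\langle x,x\rangle_\epsilon=1\}$ (with the extra condition $x_0>0$ if $\epsilon=-1$), with the Riemannian metric induced by $\epsilon\langle\cdot,\cdot\rangle_\epsilon$; thus $\mathbb M_1=\mathbb S^{n+1}$ and $\mathbb M_{-1}=\mathbb H^{n+1}$. Let $\mathbb L\subset\Lambda^2(\mathbb R^{n+2})$ be the $2n$-dimensional manifold of oriented geodesics of $\mathbb M_\epsilon$, where the geodesic through $x\in\mathbb M_\epsilon$ with unit velocity $y$ is represented by $x\wedge y$. Its tangent space at $x\wedge y$ consists of the bivectors $x\wedge X+y\wedge Y$ with $X,Y$ orthogonal to $x$ and $y$. Let $\mathbb G$ be the pseudo-Riemannian metric on $\mathbb L$ induced by the flat metric $\langle\langle x\wedge y,z\wedge w\rangle\rangle=\langle x,z\rangle_\epsilon\langle y,w\rangle_\epsilon-\langle x,w\rangle_\epsilon\langle y,z\rangle_\epsilon$ of $\Lambda^2(\mathbb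 R^{n+2})$, and let $\mathbb J$ be the complex ($\epsilon=1$), respectively paracomplex ($\epsilon=-1$), structure $\mathbb J(x\wedge X+y\wedge Y)=y\wedge X-\epsilon\, x\wedge Y$. Let $\Sigma$ be a smooth $n$-dimensional manifold and $\phi:\Sigma\to\mathbb M_\epsilon$ a smooth immersion (for example the inclusion of a submanifold). Its tangent hypersurface $\mathcal H(\Sigma)$ is given by the map $(x,v)\mapsto\phi(x)\wedge v$ from the unit tangent bundle of $\Sigma$ to $\mathbb L$; its image is the set of oriented geodesics tangent to $\Sigma$. It is called a Hopf hypersurface of $(\mathbb L,\mathbb J,\mathbb G)$ if this map is an immersion with non-degenerate induced metric, and at each point the structure vector $\xi=-\mathbb J\bar N$, where $\bar N$ is a local unit normal field ($\mathbb G(\bar N,\bar N)=\pm1$), is a principal direction, i.e. an eigenvector of the shape operator $X\mapsto-D_X\bar N$, where $D$ is the Levi-Civita connection of $\mathbb G$. Then $\mathcal H(\Sigma)$ is a Hopf hypersurface of $(\mathbb L,\mathbb J,\mathbb G)$ if and only if $\Sigma$ is totally umbilic and non-flat, that is: at every point $x$ of $\Sigma$ the second fundamental form $h$ and the first fundamental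 form $g$ of $\phi$ in $\mathbb M_\epsilon$ satisfy $h=\lambda(x)\,g$ for some number $\lambda(x)$, and $h$ does not vanish at any point (so $\lambda(x)\neq0$ for all $x$). -/

import Mathlib

open scoped Manifold ContDiff

noncomputable section

/-! ### The ambient space and the space forms -/

/-- The ambient vector space `ℝ^{n+2}`. -/
abbrev Amb (n : ℕ) : Type := Fin (n + 2) → ℝ

/-- The diagonal of the flat metric: `1` in the zeroth coordinate, `ε` in the other ones. -/
def eta {n : ℕ} (ε : ℝ) (i : Fin (n + 2)) : ℝ := if i = 0 then 1 else ε

/-- The flat metric `⟨x, y⟩_ε = x₀ y₀ + ε (x₁ y₁ + ⋯ + x_{n+1} y_{n+1})` of `ℝ^{n+2}`. -/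
def form {n : ℕ} (ε : ℝ) (x y : Amb n) : ℝ := ∑ i, eta ε i * x i * y i

/-- The space form. For `ε = 1` it is the round sphere `S^{n+1}`. For `ε = -1` it is the upper sheet
of the hyperboloid `⟨x, x⟩ = 1`; with the metric `-⟨·,·⟩` it is the hyperbolic space `H^{n+1}`. In both
cases the Riemannian metric is the restriction of `ε ⟨·,·⟩_ε`. -/
def SpaceForm (n : ℕ) (ε : ℝ) : Set (Amb n) :=
  {x | form ε x x = 1 ∧ (ε = -1 → 0 < x 0)}

/-! ### The space of oriented geodesics with its metric and its (para-)complex structure -/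

/-- Square matrices of size `n + 2`. The second exterior power of `ℝ^{n+2}` is identified with the
skew-symmetric ones; all bivectors below are of this kind. -/
abbrev Biv (n : ℕ) : Type := Fin (n + 2) → Fin (n + 2) → ℝ

/-- The bivector `x ∧ y`. -/
def wedge {n : ℕ} (x y : Amb n) : Biv n := fun i j => x i * y j - y i * x j

/-- The flat metric on bivectors, see `bivForm_wedge`. -/
def bivForm {n : ℕ} (ε : ℝ) (A B : Biv n) : ℝ :=
  (1 / 2) * ∑ i, ∑ j, eta ε i * eta ε j * A i j * B i j

/-- A point `x` of the space form and a unit vector `y` tangent to the space form at `x`. -/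
structure IsFrame {n : ℕ} (ε : ℝ) (x y : Amb n) : Prop where
  mem : x ∈ SpaceForm n ε
  orth : form ε x y = 0
  unit : form ε y y = ε

/-- The space of oriented geodesics of the space form: the oriented geodesic through `x` with
unit velocity `y` is the bivector `x ∧ y`. -/
def GeodesicSpace (n : ℕ) (ε : ℝ) : Set (Biv n) :=
  {p | ∃ x y, IsFrame ε x y ∧ p = wedge x y}

/-- The tangent space of the space of oriented geodesics at `p = x ∧ y`: all `x ∧ X + y ∧ Y` with
`X` and `Y` orthogonal to `x` and `y`. -/
def geodesicTangent {n : ℕ} (ε : ℝ) (p : Biv n) : Set (Biv n) :=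
  {W | ∃ x y X Y : Amb n, IsFrame ε x y ∧ p = wedge x y ∧
    form ε x X = 0 ∧ form ε y X = 0 ∧ form ε x Y = 0 ∧ form ε y Y = 0 ∧
    W = wedge x X + wedge y Y}

/-- The complex (`ε = 1`) or paracomplex (`ε = -1`) structure on the tangent space at `p`. At
`p = x ∧ y` it maps `x ∧ X + y ∧ Y` to `y ∧ X - ε x ∧ Y`, see `structJ_wedge`; this formula does
not mention the frame `x, y`. -/
def structJ {n : ℕ} (ε : ℝ) (p W : Biv n) : Biv n :=
  fun i j => ∑ k, eta ε k * (W i k * p k j - p i k * W k j)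

theorem bivForm_wedge {n : ℕ} (ε : ℝ) (x y z w : Amb n) :
    bivForm ε (wedge x y) (wedge z w)
      = form ε x z * form ε y w - form ε x w * form ε y z := by
  have e : ∀ a b c d : Amb n, form ε a b * form ε c d
      = ∑ i, ∑ j, (eta ε i * a i * b i) * (eta ε j * c j * d j) := fun a b c d => by
    simp only [form, Finset.sum_mul_sum]
  have h1 : form ε x z * form ε y w - form ε x w * form ε y z
      = (1 / 2) * (form ε x z * form ε y w - form ε x w * form ε y z
        - form ε y z * form ε x w + form ε y w * form ε x z) := by ring
  rw [h1, e, e, e, e, bivForm]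
  simp only [← Finset.sum_add_distrib, ← Finset.sum_sub_distrib, wedge]
  congr 1
  refine Finset.sum_congr rfl fun i _ => Finset.sum_congr rfl fun j _ => ?_
  ring

theorem structJ_wedge {n : ℕ} (ε : ℝ) (x y X Y : Amb n) (h : IsFrame ε x y)
    (hxX : form ε x X = 0) (hyX : form ε y X = 0) (hxY : form ε x Y = 0) (hyY : form ε y Y = 0) :
    structJ ε (wedge x y) (wedge x X + wedge y Y) = wedge y X - ε • wedge x Y := by
  have hxx := h.mem.1
  have hxy := h.orth
  have hyy := h.unit
  ext i j
  have key : structJ ε (wedge x y) (wedge x X + wedge y Y) i j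
      = x i * (form ε x X * y j - form ε y X * x j) - X i * (form ε x x * y j - form ε x y * x j)
        + y i * (form ε x Y * y j - form ε y Y * x j) - Y i * (form ε x y * y j - form ε y y * x j)
        - x i * (form ε x y * X j - form ε y X * x j) + y i * (form ε x x * X j - form ε x X * x j)
        - x i * (form ε y y * Y j - form ε y Y * y j) + y i * (form ε x y * Y j - form ε x Y * y j)
        := by
    simp only [structJ, form, wedge, Pi.add_apply, Finset.sum_mul, Finset.mul_sum,
      ← Finset.sum_add_distrib, ← Finset.sum_sub_distrib]
    refine Finset.sum_congr rfl fun k _ => ?_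
    ring
  rw [key, hxX, hyX, hxY, hyY, hxx, hxy, hyy]
  simp only [wedge, Pi.sub_apply, Pi.smul_apply, smul_eq_mul]
  ring

/-- `W` is the orthogonal projection of the bivector `B` to the tangent space of the space of
oriented geodesics at `p`. If `B` is the flat derivative of a tangent vector field in some direction,
then `W` is its covariant derivative for the Levi-Civita connection of the induced metric. -/
def IsTangentialPart {n : ℕ} (ε : ℝ) (p B W : Biv n) : Prop :=
  W ∈ geodesicTangent ε p ∧ ∀ Z ∈ geodesicTangent ε p, bivForm ε (B - W) Z = 0

/-! ### Hopf hypersurfaces -/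

/-- Parameter space for pieces of real hypersurfaces of the `2n`-dimensional space of geodesics. -/
abbrev Par (n : ℕ) : Type := EuclideanSpace ℝ (Fin (2 * n - 1))

/-- `ν` is a unit normal at parameter `u` of the hypersurface piece `F`. -/
structure IsUnitNormalAt {n : ℕ} (ε : ℝ) (F : Par n → Biv n) (u : Par n) (ν : Biv n) : Prop where
  tangent : ν ∈ geodesicTangent ε (F u)
  normal : ∀ X, bivForm ε ν (fderiv ℝ F u X) = 0
  unit : bivForm ε ν ν = 1 ∨ bivForm ε ν ν = -1

/-- With the unit normal field `ν` along `F`, the structure vector `ξ = -J ν` at `u` is tangent to the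
hypersurface, `ξ = dF(X)`, and is a principal direction: `A ξ = κ ξ` where `A ξ = -D_ξ ν`. -/
def IsHopfAt {n : ℕ} (ε : ℝ) (F ν : Par n → Biv n) (u : Par n) : Prop :=
  ∃ (κ : ℝ) (X : Par n), fderiv ℝ F u X = -structJ ε (F u) (ν u) ∧
    IsTangentialPart ε (F u) (fderiv ℝ ν u X) (-(κ • -structJ ε (F u) (ν u)))

/-- The map `F` on the open set `U` parametrizes a (smoothly immersed, nondegenerate) Hopf
hypersurface of the space of oriented geodesics. -/
structure IsHopfPatch {n : ℕ} (ε : ℝ) (U : Set (Par n)) (F : Par n → Biv n) : Prop where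
  smooth : ContDiffOn ℝ ∞ F U
  mapsTo : Set.MapsTo F U (GeodesicSpace n ε)
  immersion : ∀ u ∈ U, Function.Injective (fderiv ℝ F u)
  hopf : ∀ u₀ ∈ U, ∃ (V : Set (Par n)) (ν : Par n → Biv n), IsOpen V ∧ u₀ ∈ V ∧ V ⊆ U ∧
    ContDiffOn ℝ ∞ ν V ∧ ∀ u ∈ V, IsUnitNormalAt ε F u (ν u) ∧ IsHopfAt ε F ν u

section Hypersurface

variable {n : ℕ} {M : Type*} [TopologicalSpace M] [ChartedSpace (EuclideanSpace ℝ (Fin n)) M]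

/-! ### Hypersurfaces of the space form and their tangent hypersurfaces -/

/-- `φ` is a smooth immersion of the `n`-dimensional manifold `M` into the space form. -/
structure IsImmersedHypersurface (ε : ℝ) (φ : M → Amb n) : Prop where
  smooth : ContMDiff 𝓘(ℝ, EuclideanSpace ℝ (Fin n)) 𝓘(ℝ, Amb n) ∞ φ
  mem : ∀ x, φ x ∈ SpaceForm n ε
  immersion : ∀ x,
    Function.Injective (mfderiv 𝓘(ℝ, EuclideanSpace ℝ (Fin n)) 𝓘(ℝ, Amb n) φ x)

/-- The differential of `φ` at `x`, with values in `ℝ^{n+2}`. -/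
def dphi (φ : M → Amb n) (x : M) (X : EuclideanSpace ℝ (Fin n)) : Amb n :=
  mfderiv 𝓘(ℝ, EuclideanSpace ℝ (Fin n)) 𝓘(ℝ, Amb n) φ x X

/-- `v` is a unit vector tangent to the hypersurface `φ` at `x`. -/
def IsUnitTangent (ε : ℝ) (φ : M → Amb n) (x : M) (v : Amb n) : Prop :=
  v ∈ Set.range (dphi φ x) ∧ form ε v v = ε

/-- `u ↦ (c u, v u)` is a local parametrization, on the open set `U`, of the unit tangent bundle of
the hypersurface `φ`, a manifold of dimension `2n - 1` that is immersed in `ℝ^{n+2} × ℝ^{n+2}` by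
`(x, v) ↦ (φ x, v)`. -/
structure IsUnitTangentParam (ε : ℝ) (φ : M → Amb n) (U : Set (Par n))
    (c : Par n → M) (v : Par n → Amb n) : Prop where
  isOpen : IsOpen U
  smooth_base : ContMDiffOn 𝓘(ℝ, Par n) 𝓘(ℝ, EuclideanSpace ℝ (Fin n)) ∞ c U
  smooth_vec : ContDiffOn ℝ ∞ v U
  unitTangent : ∀ u ∈ U, IsUnitTangent ε φ (c u) (v u)
  immersion : ∀ u ∈ U, Function.Injective (fderiv ℝ (fun w => (φ (c w), v w)) u)

/-- The tangent hypersurface of `φ`, which is the family `(x, v) ↦ φ x ∧ v` of the oriented geodesics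
tangent to `φ`, indexed by the unit tangent bundle, is an (immersed) Hopf hypersurface of the space of
oriented geodesics: around each unit tangent vector it is parametrized as one. -/
def TangentHypersurfaceIsHopf (ε : ℝ) (φ : M → Amb n) : Prop :=
  ∀ (x₀ : M) (v₀ : Amb n), IsUnitTangent ε φ x₀ v₀ →
    ∃ (U : Set (Par n)) (c : Par n → M) (v : Par n → Amb n),
      IsUnitTangentParam ε φ U c v ∧ (∃ u ∈ U, c u = x₀ ∧ v u = v₀) ∧
      IsHopfPatch ε U (fun u => wedge (φ (c u)) (v u))

/-! ### The second fundamental form -/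

/-- `N` is a unit normal at `x` of the hypersurface `φ` in the space form. -/
structure IsUnitNormalVector (ε : ℝ) (φ : M → Amb n) (x : M) (N : Amb n) : Prop where
  tangent : form ε (φ x) N = 0
  normal : ∀ X, form ε (dphi φ x X) N = 0
  unit : form ε N N = ε

/-- The first fundamental form of `φ` at `x`, for the Riemannian metric `ε ⟨·,·⟩_ε`. -/
def firstForm (ε : ℝ) (φ : M → Amb n) (x : M) (X Y : EuclideanSpace ℝ (Fin n)) : ℝ :=
  ε * form ε (dphi φ x X) (dphi φ x Y)

/-- The second fundamental form of `φ` at `x` in direction of the unit normal `N`: the component along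
`N` of the second derivative of `φ`, in the chart at `x` that Mathlib uses to identify the tangent
space at `x` with the model space. -/
def secondForm (ε : ℝ) (φ : M → Amb n) (x : M) (N : Amb n)
    (X Y : EuclideanSpace ℝ (Fin n)) : ℝ :=
  ε * form ε
    (fderiv ℝ (fderiv ℝ (φ ∘ (extChartAt 𝓘(ℝ, EuclideanSpace ℝ (Fin n)) x).symm))
      (extChartAt 𝓘(ℝ, EuclideanSpace ℝ (Fin n)) x x) X Y) N

/-- At each point the second fundamental form is a multiple of the first one. -/
def IsTotallyUmbilic (ε : ℝ) (φ : M → Amb n) : Prop :=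
  ∀ (x : M) (N : Amb n), IsUnitNormalVector ε φ x N →
    ∃ l : ℝ, ∀ X Y, secondForm ε φ x N X Y = l * firstForm ε φ x X Y

/-- At no point does the second fundamental form vanish. -/
def IsNonFlat (ε : ℝ) (φ : M → Amb n) : Prop :=
  ∀ (x : M) (N : Amb n), IsUnitNormalVector ε φ x N → ∃ X Y, secondForm ε φ x N X Y ≠ 0

end Hypersurface

end

/-!
The proof computes with first order data only. Let `p = φ x`, let `v` be a unit tangent vector of the
hypersurface at `x`, and let `N` be the unit normal field of the hypersurface. A variation `(p', v')`
of `(p, v)` in the unit tangent bundle is restricted only by the derivatives of `⟨p, v⟩ = 0`,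
`⟨v, v⟩ = ε` and `⟨N, v⟩ = 0` (`UnitTangentJet.exists_direction`, a dimension count). The tangent
hypersurface moves by `p' ∧ v + p ∧ v'`. In the geodesic direction, `p' = v` and `v' = -ε p + k N`,
where `k` is the normal curvature of `v`, so that the velocity is `k p ∧ N`; therefore the tangent
hypersurface is immersed exactly where `k ≠ 0` (`UnitTangentJet.injective_iff`). The other directions
are spanned, modulo `p ∧ N`, by `p ∧ w` and `v ∧ w` with `w` tangent to the hypersurface and orthogonal
to `v`. Hence the unit normal is `± v ∧ N` (`UnitTangentJet.eq_smul_wedge_normal`), and the structure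
vector is a multiple of `p ∧ N`, so it is the geodesic direction.

In that direction the derivative of `v ∧ N` is `-ε p ∧ N + v ∧ N'`, where `-N'` is the image of `v` under
the shape operator. It is a multiple of `p ∧ N` if and only if `N'` is a multiple of `v`, that is, if
`v` is a principal direction of the hypersurface (`UnitTangentJet.form_shape_eq_zero` and
`UnitTangentJet.exists_principal`). All unit tangent vectors at a point are principal directions
precisely if the point is umbilic (`exists_eq_mul_of_orthogonal`), and `k ≠ 0` then says that the point
is not flat.

Two constructions connect this with the manifold: a smooth local unit normal field
(`exists_localHypersurface`) and a local parametrization of the unit tangent bundle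
(`exists_isUnitTangentParam`). The second fundamental form is expressed through the derivative of the
normal field in a fixed chart (`exists_transition`), because the definition uses a different chart at
each point.
-/

noncomputable section

/-! ### Algebra of the flat metrics -/

section Algebra

variable {n : ℕ} {ε : ℝ}

theorem form_comm (x y : Amb n) : form ε x y = form ε y x :=
  Finset.sum_congr rfl fun _ _ => by ring

theorem form_add_right (x y z : Amb n) : form ε x (y + z) = form ε x y + form ε x z := by
  simp only [form, ← Finset.sum_add_distrib, Pi.add_apply]
  exact Finset.sum_congr rfl fun _ _ => by ring

theorem form_smul_right (a : ℝ) (x y : Amb n) : form ε x (a • y) = a * form ε x y := by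
  simp only [form, Finset.mul_sum, Pi.smul_apply, smul_eq_mul]
  exact Finset.sum_congr rfl fun _ _ => by ring

theorem form_add_left (x y z : Amb n) : form ε (x + y) z = form ε x z + form ε y z := by
  rw [form_comm, form_add_right, form_comm z, form_comm z]

theorem form_smul_left (a : ℝ) (x y : Amb n) : form ε (a • x) y = a * form ε x y := by
  rw [form_comm, form_smul_right, form_comm]

/-- The flat metric of `ℝ^{n+2}` as a continuous bilinear map. -/
def formL (n : ℕ) (ε : ℝ) : Amb n →L[ℝ] Amb n →L[ℝ] ℝ :=
  (LinearMap.mk₂ ℝ (form ε) form_add_left form_smul_left form_add_right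
    form_smul_right).toContinuousBilinearMap

theorem formL_apply (x y : Amb n) : formL n ε x y = form ε x y := rfl

theorem form_zero_right (x : Amb n) : form ε x 0 = 0 := (formL n ε x).map_zero

theorem form_zero_left (x : Amb n) : form ε 0 x = 0 := by rw [form_comm, form_zero_right]

theorem form_neg_right (x y : Amb n) : form ε x (-y) = -form ε x y := (formL n ε x).map_neg y

theorem form_neg_left (x y : Amb n) : form ε (-x) y = -form ε x y := by
  rw [form_comm, form_neg_right, form_comm]

theorem form_sub_right (x y z : Amb n) : form ε x (y - z) = form ε x y - form ε x z :=
  (formL n ε x).map_sub y z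

theorem form_sub_left (x y z : Amb n) : form ε (x - y) z = form ε x z - form ε y z := by
  rw [form_comm, form_sub_right, form_comm z, form_comm z]

theorem curvature_mul_self (hε : ε = 1 ∨ ε = -1) : ε * ε = 1 := by
  rcases hε with rfl | rfl <;> norm_num

theorem eta_mul_self (hε : ε = 1 ∨ ε = -1) (i : Fin (n + 2)) : eta ε i * eta ε i = 1 := by
  unfold eta; split_ifs
  · norm_num
  · exact curvature_mul_self hε

theorem eq_zero_of_form_eq_zero (hε : ε = 1 ∨ ε = -1) {z : Amb n} (h : ∀ y, form ε z y = 0) :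
    z = 0 := by
  funext i
  have h1 := h (Pi.single i 1)
  simp only [form, Pi.single_apply, mul_ite, mul_one, mul_zero, Finset.sum_ite_eq',
    Finset.mem_univ, if_true] at h1
  have h2 := eta_mul_self hε i
  have : z i = eta ε i * (eta ε i * z i) := by rw [← mul_assoc, h2, one_mul]
  rw [this, h1, mul_zero, Pi.zero_apply]

theorem form_eq_head_add_tail (x y : Amb n) :
    form ε x y = x 0 * y 0 + ε * ∑ i : Fin (n + 1), x i.succ * y i.succ := by
  rw [form, Fin.sum_univ_succ, Finset.mul_sum]
  simp only [eta, if_true, Fin.succ_ne_zero, if_false, one_mul, mul_assoc]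

/-- The metric of the space form is Riemannian. For the hyperboloid this is the reversed
Cauchy-Schwarz inequality. -/
theorem form_self_pos (hε : ε = 1 ∨ ε = -1) {x z : Amb n} (hx : form ε x x = 1)
    (hxz : form ε x z = 0) (hz : z ≠ 0) : 0 < ε * form ε z z := by
  rw [form_eq_head_add_tail] at hx hxz ⊢
  have hcs := Finset.sum_mul_sq_le_sq_mul_sq Finset.univ
    (fun i : Fin (n + 1) => x i.succ) (fun i => z i.succ)
  have hpos : 0 < z 0 ^ 2 + ∑ i : Fin (n + 1), z i.succ ^ 2 := by
    have h0 : z 0 ^ 2 + ∑ i : Fin (n + 1), z i.succ ^ 2 = ∑ i, z i ^ 2 :=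
      (Fin.sum_univ_succ (fun i => z i ^ 2)).symm
    rw [h0]
    obtain ⟨i, hi⟩ := Function.ne_iff.mp hz
    exact Finset.sum_pos' (fun _ _ => sq_nonneg _) ⟨i, Finset.mem_univ _, by
      have : z i ≠ 0 := hi
      positivity⟩
  simp only [← pow_two] at hx ⊢
  set P := ∑ i : Fin (n + 1), x i.succ ^ 2
  set Q := ∑ i : Fin (n + 1), z i.succ ^ 2
  set R := ∑ i : Fin (n + 1), x i.succ * z i.succ
  have hP : 0 ≤ P := Finset.sum_nonneg fun _ _ => sq_nonneg _
  rcases hε with rfl | rfl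
  · linarith
  · have hx' : x 0 ^ 2 = 1 + P := by linarith
    have hR : R = x 0 * z 0 := by linarith
    rw [hR, mul_pow, hx'] at hcs
    -- `(1 + P) z₀² ≤ P Q` and `z₀² + Q > 0`
    by_contra! hle
    have h1 : Q ≤ z 0 ^ 2 := by linarith
    have h2 : P * Q ≤ P * z 0 ^ 2 := mul_le_mul_of_nonneg_left h1 hP
    nlinarith

theorem wedge_add_left (x y z : Amb n) : wedge (x + y) z = wedge x z + wedge y z := by
  ext i j; simp only [wedge, Pi.add_apply]; ring

theorem wedge_smul_left (a : ℝ) (x y : Amb n) : wedge (a • x) y = a • wedge x y := by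
  ext i j; simp only [wedge, Pi.smul_apply, smul_eq_mul]; ring

theorem wedge_add_right (x y z : Amb n) : wedge x (y + z) = wedge x y + wedge x z := by
  ext i j; simp only [wedge, Pi.add_apply]; ring

theorem wedge_smul_right (a : ℝ) (x y : Amb n) : wedge x (a • y) = a • wedge x y := by
  ext i j; simp only [wedge, Pi.smul_apply, smul_eq_mul]; ring

theorem wedge_self (x : Amb n) : wedge x x = 0 := by
  ext i j; simp only [wedge, Pi.zero_apply]; ring

theorem wedge_swap (x y : Amb n) : wedge y x = -wedge x y := by
  ext i j; simp only [wedge, Pi.neg_apply]; ring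

/-- The exterior product as a continuous bilinear map. -/
def wedgeL (n : ℕ) : Amb n →L[ℝ] Amb n →L[ℝ] Biv n :=
  (LinearMap.mk₂ ℝ wedge wedge_add_left wedge_smul_left wedge_add_right
    wedge_smul_right).toContinuousBilinearMap

theorem wedgeL_apply (x y : Amb n) : wedgeL n x y = wedge x y := rfl

theorem wedge_zero_right (x : Amb n) : wedge x 0 = 0 := (wedgeL n x).map_zero

theorem bivForm_add_left (A B C : Biv n) :
    bivForm ε (A + B) C = bivForm ε A C + bivForm ε B C := by
  simp only [bivForm, ← mul_add, ← Finset.sum_add_distrib, Pi.add_apply]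
  congr 1
  exact Finset.sum_congr rfl fun _ _ => Finset.sum_congr rfl fun _ _ => by ring

theorem bivForm_smul_left (a : ℝ) (A B : Biv n) :
    bivForm ε (a • A) B = a * bivForm ε A B := by
  simp only [bivForm, Finset.mul_sum, Pi.smul_apply, smul_eq_mul]
  exact Finset.sum_congr rfl fun _ _ => Finset.sum_congr rfl fun _ _ => by ring

theorem bivForm_comm (A B : Biv n) : bivForm ε A B = bivForm ε B A := by
  simp only [bivForm]
  congr 1
  exact Finset.sum_congr rfl fun _ _ => Finset.sum_congr rfl fun _ _ => by ring

theorem bivForm_add_right (A B C : Biv n) :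
    bivForm ε A (B + C) = bivForm ε A B + bivForm ε A C := by
  rw [bivForm_comm, bivForm_add_left, bivForm_comm B, bivForm_comm C]

theorem bivForm_smul_right (a : ℝ) (A B : Biv n) :
    bivForm ε A (a • B) = a * bivForm ε A B := by
  rw [bivForm_comm, bivForm_smul_left, bivForm_comm]

/-- The flat metric on bivectors as a continuous bilinear map. -/
def bivFormL (n : ℕ) (ε : ℝ) : Biv n →L[ℝ] Biv n →L[ℝ] ℝ :=
  (LinearMap.mk₂ ℝ (bivForm ε) bivForm_add_left bivForm_smul_left bivForm_add_right
    bivForm_smul_right).toContinuousBilinearMap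

theorem bivFormL_apply (A B : Biv n) : bivFormL n ε A B = bivForm ε A B := rfl

theorem structJ_smul (a : ℝ) (p W : Biv n) : structJ ε p (a • W) = a • structJ ε p W := by
  ext i j
  simp only [structJ, Pi.smul_apply, smul_eq_mul, Finset.mul_sum]
  exact Finset.sum_congr rfl fun _ _ => by ring

/-- Contraction of a bivector with a vector by means of the flat metric. -/
def contract (ε : ℝ) (A : Biv n) (z : Amb n) : Amb n := fun i => ∑ j, eta ε j * A i j * z j

theorem contract_wedge (x y z : Amb n) :
    contract ε (wedge x y) z = form ε y z • x - form ε x z • y := by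
  ext i
  simp only [contract, wedge, form, Pi.sub_apply, Pi.smul_apply, smul_eq_mul, Finset.sum_mul,
    ← Finset.sum_sub_distrib]
  exact Finset.sum_congr rfl fun _ _ => by ring

theorem contract_add (A B : Biv n) (z : Amb n) :
    contract ε (A + B) z = contract ε A z + contract ε B z := by
  ext i
  simp only [contract, Pi.add_apply, ← Finset.sum_add_distrib]
  exact Finset.sum_congr rfl fun _ _ => by ring

theorem contract_zero (z : Amb n) : contract ε (0 : Biv n) z = 0 := by
  ext i; simp [contract]

/-! ### Frames of an oriented geodesic -/

/-- A vector of the plane spanned by the frame `z, w` is a combination of any other frame `x, y` of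
the same geodesic. -/
theorem IsFrame.span {x y z w : Amb n} (hε : ε = 1 ∨ ε = -1) (h' : IsFrame ε z w)
    (he : wedge x y = wedge z w) :
    (∃ a b : ℝ, z = a • x + b • y) ∧ ∃ c d : ℝ, w = c • x + d • y := by
  have hs := curvature_mul_self hε
  constructor
  · refine ⟨ε * form ε y w, -(ε * form ε x w), ?_⟩
    have h1 := congrArg (fun A => contract ε A w) he
    simp only [contract_wedge, h'.orth, h'.unit, zero_smul, sub_zero] at h1
    have h2 : z = ε • (ε • z) := by rw [smul_smul, hs, one_smul]
    rw [h2, ← h1]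
    module
  · refine ⟨-form ε y z, form ε x z, ?_⟩
    have h1 := congrArg (fun A => contract ε A z) he
    simp only [contract_wedge, h'.mem.1, form_comm w z, h'.orth, zero_smul, zero_sub,
      one_smul] at h1
    have h2 : w = -(-w) := by simp
    rw [h2, ← h1]
    module

/-- The tangent space of the space of oriented geodesics may be computed in any frame. -/
theorem mem_geodesicTangent_iff (hε : ε = 1 ∨ ε = -1) {x y : Amb n} (h : IsFrame ε x y)
    {W : Biv n} :
    W ∈ geodesicTangent ε (wedge x y) ↔ ∃ X Y : Amb n, form ε x X = 0 ∧ form ε y X = 0 ∧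
      form ε x Y = 0 ∧ form ε y Y = 0 ∧ W = wedge x X + wedge y Y := by
  constructor
  · rintro ⟨z, w, X, Y, h', he, h1, h2, h3, h4, rfl⟩
    obtain ⟨⟨a, b, hz⟩, c, d, hw⟩ := h'.span hε he
    obtain ⟨⟨a', b', hx⟩, c', d', hy⟩ := h.span hε he.symm
    have ex : ∀ V, form ε z V = 0 → form ε w V = 0 → form ε x V = 0 := fun V hz hw => by
      rw [hx, form_add_left, form_smul_left, form_smul_left, hz, hw]; ring
    have ey : ∀ V, form ε z V = 0 → form ε w V = 0 → form ε y V = 0 := fun V hz hw => by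
      rw [hy, form_add_left, form_smul_left, form_smul_left, hz, hw]; ring
    have ec : ∀ (r s : ℝ) (u : Amb n), form ε u X = 0 → form ε u Y = 0 →
        form ε u (r • X + s • Y) = 0 := fun r s u hX hY => by
      rw [form_add_right, form_smul_right, form_smul_right, hX, hY]; ring
    refine ⟨a • X + c • Y, b • X + d • Y, ec _ _ _ (ex _ h1 h2) (ex _ h3 h4),
      ec _ _ _ (ey _ h1 h2) (ey _ h3 h4), ec _ _ _ (ex _ h1 h2) (ex _ h3 h4),
      ec _ _ _ (ey _ h1 h2) (ey _ h3 h4), ?_⟩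
    conv_lhs => rw [hz, hw]
    simp only [wedge_add_left, wedge_add_right, wedge_smul_left, wedge_smul_right]
    module
  · rintro ⟨X, Y, h1, h2, h3, h4, rfl⟩
    exact ⟨x, y, X, Y, h, rfl, h1, h2, h3, h4, rfl⟩

end Algebra

/-! ### First order data of a hypersurface and of its unit tangent bundle -/

section Jets

variable {n : ℕ} {ε : ℝ}

/-- The values at a point of a local parametrization (`p`), of a unit normal field (`N`), and of the
differentials of both (`D` and `S`), for a hypersurface of the space form. As `S` is the differential
of `N`, the shape operator is determined by `D (A X) = -S X`. -/
structure HypersurfaceJet (ε : ℝ) (p N : Amb n) (D S : EuclideanSpace ℝ (Fin n) →L[ℝ] Amb n) :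
    Prop where
  mem : p ∈ SpaceForm n ε
  inj : Function.Injective D
  tangent : ∀ X, form ε p (D X) = 0
  base_normal : form ε p N = 0
  normal : ∀ X, form ε N (D X) = 0
  unit : form ε N N = ε
  base_shape : ∀ X, form ε p (S X) = 0
  normal_shape : ∀ X, form ε N (S X) = 0

/-- The value `v` and the differentials `L`, `V` at a parameter of a local parametrization of the unit
tangent bundle of a hypersurface with first order data `p, N, D, S`; here `L` is the differential of
the footpoint in the domain of the local parametrization, and `V` that of the unit vector. The
equations for `V` are the derivatives of `⟨p, v⟩ = 0`, `⟨v, v⟩ = ε` and `⟨N, v⟩ = 0`. -/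
structure UnitTangentJet (ε : ℝ) (p N : Amb n) (D S : EuclideanSpace ℝ (Fin n) →L[ℝ] Amb n)
    (v : Amb n) (L : Par n →L[ℝ] EuclideanSpace ℝ (Fin n)) (V : Par n →L[ℝ] Amb n) : Prop where
  range : ∃ ζ, D ζ = v
  unit : form ε v v = ε
  base : ∀ e, form ε p (V e) = -form ε (D (L e)) v
  vec : ∀ e, form ε v (V e) = 0
  normal : ∀ e, form ε N (V e) = -form ε (S (L e)) v
  inj : ∀ e, L e = 0 → V e = 0 → e = 0

variable {p N v : Amb n} {D S : EuclideanSpace ℝ (Fin n) →L[ℝ] Amb n}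
  {L : Par n →L[ℝ] EuclideanSpace ℝ (Fin n)} {V : Par n →L[ℝ] Amb n}

theorem HypersurfaceJet.exists_decomposition (hε : ε = 1 ∨ ε = -1)
    (h : HypersurfaceJet ε p N D S) (z : Amb n) : ∃ (s : ℝ) (X : EuclideanSpace ℝ (Fin n)) (t : ℝ),
      z = s • p + D X + t • N := by
  have hε0 : ε ≠ 0 := by rcases hε with rfl | rfl <;> norm_num
  let B : ℝ × EuclideanSpace ℝ (Fin n) × ℝ →ₗ[ℝ] Amb n :=
    (LinearMap.toSpanSingleton ℝ (Amb n) p).coprod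
      (D.toLinearMap.coprod (LinearMap.toSpanSingleton ℝ (Amb n) N))
  have hB : ∀ s X t, B (s, X, t) = s • p + D X + t • N := fun s X t => by
    simp [B, LinearMap.toSpanSingleton_apply, add_assoc]
  have hinj : Function.Injective B := by
    rw [← LinearMap.ker_eq_bot, LinearMap.ker_eq_bot']
    rintro ⟨s, X, t⟩ h0
    rw [hB] at h0
    have h1 := congrArg (form ε p) h0
    have h2 := congrArg (form ε N) h0
    simp only [form_add_right, form_smul_right, h.mem.1, h.tangent, h.base_normal,
      form_zero_right, h.normal, h.unit, form_comm N p] at h1 h2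
    have hs : s = 0 := by linarith
    have ht : t = 0 := by
      have : t * ε = 0 := by linarith
      exact (mul_eq_zero.mp this).resolve_right hε0
    subst hs ht
    have hX : D X = D 0 := by simpa using h0
    rw [h.inj hX]; rfl
  have hsurj : Function.Surjective B :=
    (LinearMap.injective_iff_surjective_of_finrank_eq_finrank (by
      simp only [Module.finrank_prod, Module.finrank_self, finrank_euclideanSpace,
        Fintype.card_fin, Module.finrank_fintype_fun_eq_card]; omega)).mp hinj
  obtain ⟨⟨s, X, t⟩, hz⟩ := hsurj z
  exact ⟨s, X, t, by rw [← hz, hB]⟩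

theorem HypersurfaceJet.eq_zero (hε : ε = 1 ∨ ε = -1) (h : HypersurfaceJet ε p N D S) {z : Amb n}
    (hp : form ε p z = 0) (hN : form ε N z = 0) (hD : ∀ X, form ε (D X) z = 0) : z = 0 := by
  refine eq_zero_of_form_eq_zero hε fun y => ?_
  obtain ⟨s, X, t, rfl⟩ := h.exists_decomposition hε y
  rw [form_comm]
  simp only [form_add_left, form_smul_left, hp, hN, hD]; ring

theorem HypersurfaceJet.eq_smul_normal (hε : ε = 1 ∨ ε = -1) (h : HypersurfaceJet ε p N D S)
    {z : Amb n} (hp : form ε p z = 0) (hD : ∀ X, form ε (D X) z = 0) :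
    z = (ε * form ε N z) • N := by
  rw [← sub_eq_zero]
  have hs := curvature_mul_self hε
  refine h.eq_zero hε ?_ ?_ fun X => ?_
  · simp only [form_sub_right, form_smul_right, hp, h.base_normal]; ring
  · simp only [form_sub_right, form_smul_right, h.unit]
    linear_combination (-form ε N z) * hs
  · simp only [form_sub_right, form_smul_right, hD, form_comm _ N, h.normal]; ring

theorem UnitTangentJet.frame (h : HypersurfaceJet ε p N D S) (hv : UnitTangentJet ε p N D S v L V) :
    IsFrame ε p v := by
  obtain ⟨ζ, rfl⟩ := hv.range
  exact ⟨h.mem, h.tangent ζ, hv.unit⟩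

/-- The tangent space of the unit tangent bundle: since the dimension of the parameter space is
`2n - 1`, the linearized equations are the only restriction on the variation of `(x, v)`. -/
theorem UnitTangentJet.exists_direction (hε : ε = 1 ∨ ε = -1) (h : HypersurfaceJet ε p N D S)
    (hv : UnitTangentJet ε p N D S v L V) {X : EuclideanSpace ℝ (Fin n)} {Z : Amb n}
    (hp : form ε p Z = -form ε (D X) v) (hvec : form ε v Z = 0)
    (hN : form ε N Z = -form ε (S X) v) : ∃ e, L e = X ∧ V e = Z := by
  have hs := curvature_mul_self hε
  obtain ⟨ζ, rfl⟩ := hv.range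
  let f : EuclideanSpace ℝ (Fin n) × Amb n →ₗ[ℝ] ℝ × ℝ × ℝ :=
    LinearMap.prod
      ((formL n ε p).toLinearMap ∘ₗ LinearMap.snd ℝ _ _
        + (((formL n ε).flip (D ζ)).toLinearMap ∘ₗ D.toLinearMap) ∘ₗ LinearMap.fst ℝ _ _)
      (LinearMap.prod ((formL n ε (D ζ)).toLinearMap ∘ₗ LinearMap.snd ℝ _ _)
      ((formL n ε N).toLinearMap ∘ₗ LinearMap.snd ℝ _ _
        + (((formL n ε).flip (D ζ)).toLinearMap ∘ₗ S.toLinearMap) ∘ₗ LinearMap.fst ℝ _ _))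
  have hf : ∀ Y W, f (Y, W) = (form ε p W + form ε (D Y) (D ζ), form ε (D ζ) W,
      form ε N W + form ε (S Y) (D ζ)) := fun Y W => rfl
  have hsurj : Function.Surjective f := by
    rintro ⟨a, b, c⟩
    refine ⟨(0, a • p + (ε * b) • D ζ + (ε * c) • N), ?_⟩
    rw [hf]
    simp only [form_add_right, form_smul_right, h.mem.1, h.tangent, h.base_normal, h.normal,
      h.unit, hv.unit, form_comm _ p, form_comm (D ζ) N, map_zero, form_zero_left]
    refine Prod.ext ?_ (Prod.ext ?_ ?_) <;> dsimp only
    · ring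
    · linear_combination b * hs
    · linear_combination c * hs
  let g : Par n →ₗ[ℝ] EuclideanSpace ℝ (Fin n) × Amb n := L.toLinearMap.prod V.toLinearMap
  have hg : Function.Injective g := by
    rw [← LinearMap.ker_eq_bot, LinearMap.ker_eq_bot']
    intro e he
    exact hv.inj e (congrArg Prod.fst he) (congrArg Prod.snd he)
  have hle : LinearMap.range g ≤ LinearMap.ker f := by
    rintro _ ⟨e, rfl⟩
    rw [LinearMap.mem_ker]
    change f (L e, V e) = 0
    rw [hf, hv.base, hv.vec, hv.normal]
    simp
  have hdim := f.finrank_range_add_finrank_ker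
  have hrg := LinearMap.finrank_range_of_inj hg
  rw [LinearMap.range_eq_top.mpr hsurj, finrank_top] at hdim
  simp only [Module.finrank_prod, Module.finrank_self, finrank_euclideanSpace,
    Fintype.card_fin, Module.finrank_fintype_fun_eq_card] at hdim hrg
  have heq := Submodule.eq_of_le_of_finrank_le hle (by omega)
  have hmem : (X, Z) ∈ LinearMap.ker f := by
    rw [LinearMap.mem_ker, hf, hp, hvec, hN]; simp
  rw [← heq] at hmem
  obtain ⟨e, he⟩ := hmem
  exact ⟨e, congrArg Prod.fst he, congrArg Prod.snd he⟩

/-! ### The differential of the tangent hypersurface -/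

variable {F' : Par n →L[ℝ] Biv n}

/-- Moving the footpoint along the geodesic of the hypersurface in direction `v` moves the tangent
geodesic in the direction `p ∧ N`, with speed given by the normal curvature of `v`. -/
theorem UnitTangentJet.exists_geodesic_direction (hε : ε = 1 ∨ ε = -1)
    (h : HypersurfaceJet ε p N D S) (hv : UnitTangentJet ε p N D S v L V)
    (hF : ∀ e, F' e = wedge (D (L e)) v + wedge p (V e)) {ζ : EuclideanSpace ℝ (Fin n)}
    (hζ : D ζ = v) : ∃ e, L e = ζ ∧ V e = -(ε • p) - (ε * form ε (S ζ) v) • N ∧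
      F' e = -(ε * form ε (S ζ) v) • wedge p N := by
  have hs := curvature_mul_self hε
  have hpv := (hv.frame h).orth
  have hNv : form ε N v = 0 := by rw [← hζ, h.normal]
  obtain ⟨e, he1, he2⟩ := hv.exists_direction hε h (X := ζ)
    (Z := -(ε • p) - (ε * form ε (S ζ) v) • N)
    (by simp only [form_sub_right, form_neg_right, form_smul_right, h.mem.1, h.base_normal, hζ,
          hv.unit]; ring)
    (by simp only [form_sub_right, form_neg_right, form_smul_right, form_comm v p, form_comm v N, hpv,
          hNv]; ring)
    (by simp only [form_sub_right, form_neg_right, form_smul_right, form_comm N p, h.base_normal,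
          h.unit]; linear_combination (-form ε (S ζ) v) * hs)
  refine ⟨e, he1, he2, ?_⟩
  rw [hF, he1, he2, hζ, wedge_self, zero_add]
  have : -(ε • p) - (ε * form ε (S ζ) v) • N = (-ε) • p + (-(ε * form ε (S ζ) v)) • N := by module
  rw [this, wedge_add_right, wedge_smul_right, wedge_smul_right, wedge_self, smul_zero, zero_add]

/-- The tangent hypersurface is immersed exactly where the normal curvature of `v` is nonzero. -/
theorem UnitTangentJet.injective_iff (hε : ε = 1 ∨ ε = -1)
    (h : HypersurfaceJet ε p N D S) (hv : UnitTangentJet ε p N D S v L V)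
    (hF : ∀ e, F' e = wedge (D (L e)) v + wedge p (V e)) {ζ : EuclideanSpace ℝ (Fin n)}
    (hζ : D ζ = v) : Function.Injective F' ↔ form ε (S ζ) v ≠ 0 := by
  have hs := curvature_mul_self hε
  have hε0 : ε ≠ 0 := by rcases hε with rfl | rfl <;> norm_num
  have hfr := hv.frame h
  constructor
  · intro hinj h0
    obtain ⟨e, he, -, hFe⟩ := hv.exists_geodesic_direction hε h hF hζ
    rw [h0, mul_zero, neg_zero, zero_smul] at hFe
    have he0 : e = 0 := hinj (by rw [hFe, map_zero])
    have hv0 : v = 0 := by rw [← hζ, ← he, he0, map_zero, map_zero]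
    have := hv.unit
    rw [hv0, form_zero_left] at this
    exact hε0 this.symm
  · intro hk
    refine (injective_iff_map_eq_zero F').mpr fun e he => ?_
    rw [hF] at he
    set a := form ε (D (L e)) v
    have hcp := congrArg (fun A => contract ε A p) he
    have hcv := congrArg (fun A => contract ε A v) he
    simp only [contract_add, contract_wedge, contract_zero, form_comm v p, hfr.orth,
      form_comm _ p, h.tangent, hfr.mem.1, hfr.unit, hv.base, form_comm _ v, hv.vec,
      zero_smul, sub_zero, one_smul, zero_add, add_zero] at hcp hcv
    rw [form_comm v (D (L e))] at hcv
    -- the contractions show that footpoint and vector move along the geodesic itself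
    have hV : V e = (-a) • p := by
      rw [form_comm v (D (L e))] at hcp
      exact (sub_eq_zero.mp hcp).symm
    have hL : D (L e) = (ε * a) • v := by
      have h1 : D (L e) = ε • (ε • D (L e)) := by rw [smul_smul, hs, one_smul]
      rw [h1, sub_eq_zero.mp hcv, smul_smul]
    have hLe : L e = (ε * a) • ζ := h.inj (by rw [map_smul, hζ, hL])
    have hn := hv.normal e
    rw [hV, hLe, map_smul, form_smul_right, form_comm N p, h.base_normal, form_smul_left,
      mul_zero] at hn
    have ha : a = 0 := by
      have : ε * a * form ε (S ζ) v = 0 := by linarith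
      simpa [hε0, hk] using this
    rw [ha] at hV hLe
    exact hv.inj e (by simpa using hLe) (by simpa using hV)

/-- The tangent hypersurface contains the directions `v ∧ w` for all `w` tangent to the given
hypersurface, and `p ∧ w` if moreover `w` is orthogonal to `v`. -/
theorem UnitTangentJet.exists_directions (hε : ε = 1 ∨ ε = -1)
    (h : HypersurfaceJet ε p N D S) (hv : UnitTangentJet ε p N D S v L V)
    (hF : ∀ e, F' e = wedge (D (L e)) v + wedge p (V e)) (X : EuclideanSpace ℝ (Fin n))
    (hX : form ε (D X) v = 0) :
    (∃ e, F' e = wedge p (D X)) ∧ ∃ e, F' e = wedge (D X) v - (ε * form ε (S X) v) • wedge p N := by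
  have hs := curvature_mul_self hε
  obtain ⟨ζ, hζ⟩ := hv.range
  have hNv : form ε N v = 0 := by rw [← hζ, h.normal]
  constructor
  · obtain ⟨e, he1, he2⟩ := hv.exists_direction hε h (X := 0) (Z := D X)
      (by simp [h.tangent, form_zero_left]) (by rw [form_comm, hX])
      (by simp [h.normal, form_zero_left])
    refine ⟨e, ?_⟩
    rw [hF, he1, he2, map_zero, wedge_swap, wedge_zero_right, neg_zero, zero_add]
  · obtain ⟨e, he1, he2⟩ := hv.exists_direction hε h (X := X) (Z := (-(ε * form ε (S X) v)) • N)
      (by rw [form_smul_right, h.base_normal, hX]; ring)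
      (by rw [form_smul_right, form_comm v N, hNv]; ring)
      (by rw [form_smul_right, h.unit]; linear_combination (-form ε (S X) v) * hs)
    refine ⟨e, ?_⟩
    rw [hF, he1, he2, wedge_smul_right]
    module

theorem UnitTangentJet.wedge_normal_mem (hε : ε = 1 ∨ ε = -1) (h : HypersurfaceJet ε p N D S)
    (hv : UnitTangentJet ε p N D S v L V) : wedge v N ∈ geodesicTangent ε (wedge p v) := by
  obtain ⟨ζ, hζ⟩ := hv.range
  refine (mem_geodesicTangent_iff hε (hv.frame h)).mpr ⟨0, N, form_zero_right _, form_zero_right _,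
    h.base_normal, ?_, ?_⟩
  · rw [← hζ, form_comm, h.normal]
  · rw [wedge_zero_right, zero_add]

theorem UnitTangentJet.bivForm_wedge_normal (h : HypersurfaceJet ε p N D S)
    (hv : UnitTangentJet ε p N D S v L V)
    (hF : ∀ e, F' e = wedge (D (L e)) v + wedge p (V e)) (e : Par n) :
    bivForm ε (wedge v N) (F' e) = 0 := by
  have hpv := (hv.frame h).orth
  obtain ⟨ζ, hζ⟩ := hv.range
  have hNv : form ε N v = 0 := by rw [← hζ, h.normal]
  rw [hF, bivForm_add_right, bivForm_wedge, bivForm_wedge, hNv, h.normal, form_comm v p, hpv,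
    hv.vec]
  ring

/-- The normal bundle of the tangent hypersurface is spanned by `v ∧ N`. -/
theorem UnitTangentJet.eq_smul_wedge_normal (hε : ε = 1 ∨ ε = -1) (h : HypersurfaceJet ε p N D S)
    (hv : UnitTangentJet ε p N D S v L V)
    (hF : ∀ e, F' e = wedge (D (L e)) v + wedge p (V e)) (hinj : Function.Injective F')
    {ν : Biv n} (hν : ν ∈ geodesicTangent ε (wedge p v)) (horth : ∀ e, bivForm ε ν (F' e) = 0) :
    ν = bivForm ε ν (wedge v N) • wedge v N := by
  have hs := curvature_mul_self hε
  have hε0 : ε ≠ 0 := by rcases hε with rfl | rfl <;> norm_num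
  have hfr := hv.frame h
  obtain ⟨ζ, hζ⟩ := hv.range
  have hNv : form ε N v = 0 := by rw [← hζ, h.normal]
  obtain ⟨A, B, hpA, hvA, hpB, hvB, rfl⟩ := (mem_geodesicTangent_iff hε hfr).mp hν
  have hk := (hv.injective_iff hε h hF hζ).mp hinj
  have hdot : ∀ w, form ε p w = 0 → form ε v w = 0 →
      bivForm ε (wedge p A + wedge v B) (wedge p w) = form ε A w ∧
      bivForm ε (wedge p A + wedge v B) (wedge v w) = ε * form ε B w := fun w h1 h2 => by
    simp only [bivForm_add_left, bivForm_wedge, hfr.mem.1, hfr.unit, h1, h2, hfr.orth,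
      form_comm v p, form_comm A p, form_comm B p, hpA, hpB, form_comm A v, form_comm B v, hvA,
      hvB]
    constructor <;> ring
  have hpN : bivForm ε (wedge p A + wedge v B) (wedge p N) = 0 := by
    obtain ⟨e, -, -, he⟩ := hv.exists_geodesic_direction hε h hF hζ
    have := horth e
    rw [he, bivForm_smul_right] at this
    simpa [hε0, hk] using this
  -- a tangent vector is the sum of a multiple of `v` and of a vector orthogonal to `v`
  have hsplit : ∀ X, ∃ Y, form ε (D Y) v = 0 ∧ D X = (ε * form ε (D X) v) • v + D Y := fun X =>
    ⟨X - (ε * form ε (D X) v) • ζ, by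
      rw [map_sub, map_smul, hζ, form_sub_left, form_smul_left, hv.unit]
      linear_combination (-form ε (D X) v) * hs, by
      rw [map_sub, map_smul, hζ]; module⟩
  have hA : A = 0 := by
    refine h.eq_zero hε hpA ?_ fun X => ?_
    · rw [form_comm, ← (hdot N h.base_normal (by rw [form_comm, hNv])).1, hpN]
    · obtain ⟨Y, hY, hXY⟩ := hsplit X
      obtain ⟨⟨e, he⟩, -⟩ := hv.exists_directions hε h hF Y hY
      have h1 := horth e
      rw [he, (hdot (D Y) (h.tangent Y) (by rw [form_comm, hY])).1] at h1
      rw [hXY, form_add_left, form_smul_left, hvA, form_comm (D Y), h1]; ring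
  have hB : B = (ε * form ε N B) • N := by
    refine h.eq_smul_normal hε hpB fun X => ?_
    obtain ⟨Y, hY, hXY⟩ := hsplit X
    obtain ⟨-, e, he⟩ := hv.exists_directions hε h hF Y hY
    have h1 := horth e
    have h2 : wedge (D Y) v - (ε * form ε (S Y) v) • wedge p N
        = (-1 : ℝ) • wedge v (D Y) + (-(ε * form ε (S Y) v)) • wedge p N := by
      rw [wedge_swap v (D Y)]; module
    rw [he, h2, bivForm_add_right, bivForm_smul_right, bivForm_smul_right, hpN,
      (hdot (D Y) (h.tangent Y) (by rw [form_comm, hY])).2] at h1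
    have h3 : form ε B (D Y) = 0 := by
      have : ε * form ε B (D Y) = 0 := by linarith
      exact (mul_eq_zero.mp this).resolve_left hε0
    rw [hXY, form_add_left, form_smul_left, hvB, form_comm (D Y), h3]; ring
  rw [(hdot N h.base_normal (by rw [form_comm, hNv])).2, hA, wedge_zero_right, zero_add,
    form_comm B N]
  conv_lhs => rw [hB, wedge_smul_right]

/-- The structure vector `-J (v ∧ N)`. -/
theorem UnitTangentJet.structJ_wedge_normal (h : HypersurfaceJet ε p N D S)
    (hv : UnitTangentJet ε p N D S v L V) :
    structJ ε (wedge p v) (wedge v N) = -(ε • wedge p N) := by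
  obtain ⟨ζ, hζ⟩ := hv.range
  have h1 := structJ_wedge ε p v 0 N (hv.frame h) (form_zero_right _) (form_zero_right _)
    h.base_normal (by rw [← hζ, form_comm, h.normal])
  rw [wedge_zero_right, wedge_zero_right, zero_add, zero_sub] at h1
  exact h1

end Jets

/-! ### Local hypersurfaces with a unit normal field -/

section LocalHypersurface

variable {n : ℕ} {ε : ℝ}

theorem form_hasFDerivAt_add_eq_zero {E : Type*} [NormedAddCommGroup E] [NormedSpace ℝ E]
    {f g : E → Amb n} {f' g' : E →L[ℝ] Amb n} {u : E} {c : ℝ} (hf : HasFDerivAt f f' u)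
    (hg : HasFDerivAt g g' u) (h : ∀ᶠ w in nhds u, form ε (f w) (g w) = c) (e : E) :
    form ε (f' e) (g u) + form ε (f u) (g' e) = 0 := by
  have h1 := (formL n ε).hasFDerivAt_of_bilinear hf hg
  have h2 : HasFDerivAt (fun w => formL n ε (f w) (g w)) (0 : E →L[ℝ] ℝ) u :=
    (hasFDerivAt_const c u).congr_of_eventuallyEq h
  have h3 := congrArg (fun T : E →L[ℝ] ℝ => T e) (h1.unique h2)
  simp only [add_apply, zero_apply,
    ContinuousLinearMap.precompR_apply, ContinuousLinearMap.precompL_apply, formL_apply] at h3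
  rw [add_comm]; exact h3

theorem wedge_hasFDerivAt {E : Type*} [NormedAddCommGroup E] [NormedSpace ℝ E]
    {f g : E → Amb n} {f' g' : E →L[ℝ] Amb n} {u : E} (hf : HasFDerivAt f f' u)
    (hg : HasFDerivAt g g' u) :
    DifferentiableAt ℝ (fun w => wedge (f w) (g w)) u ∧
    ∀ e, fderiv ℝ (fun w => wedge (f w) (g w)) u e = wedge (f' e) (g u) + wedge (f u) (g' e) := by
  have h1 : HasFDerivAt (fun w => wedge (f w) (g w)) _ u :=
    (wedgeL n).hasFDerivAt_of_bilinear hf hg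
  refine ⟨h1.differentiableAt, fun e => ?_⟩
  rw [h1.fderiv]
  simp only [add_apply,
    ContinuousLinearMap.precompL_apply, wedgeL_apply]
  rw [add_comm]; rfl

theorem contDiffOn_form {E : Type*} [NormedAddCommGroup E] [NormedSpace ℝ E]
    {f g : E → Amb n} {s : Set E} (hf : ContDiffOn ℝ ∞ f s) (hg : ContDiffOn ℝ ∞ g s) :
    ContDiffOn ℝ ∞ (fun w => form ε (f w) (g w)) s :=
  ((formL n ε).contDiff.comp_contDiffOn hf).clm_apply hg

theorem contDiffOn_wedge {E : Type*} [NormedAddCommGroup E] [NormedSpace ℝ E]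
    {f g : E → Amb n} {s : Set E} (hf : ContDiffOn ℝ ∞ f s) (hg : ContDiffOn ℝ ∞ g s) :
    ContDiffOn ℝ ∞ (fun w => wedge (f w) (g w)) s :=
  ((wedgeL n).contDiff.comp_contDiffOn hf).clm_apply hg

/-- The unit vector, for the Riemannian metric `ε ⟨·,·⟩_ε`, in direction of `z`. -/
def normalized (ε : ℝ) (z : Amb n) : Amb n := (√(ε * form ε z z))⁻¹ • z

theorem form_normalized (hε : ε = 1 ∨ ε = -1) {z : Amb n} (hz : 0 < ε * form ε z z) :
    form ε (normalized ε z) (normalized ε z) = ε := by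
  have hs := curvature_mul_self hε
  have hr : 0 < √(ε * form ε z z) := Real.sqrt_pos.mpr hz
  have hr2 := Real.mul_self_sqrt hz.le
  rw [normalized, form_smul_left, form_smul_right]
  set r := √(ε * form ε z z)
  have : form ε z z = ε * (r * r) := by rw [hr2]; linear_combination (-form ε z z) * hs
  rw [this]
  field_simp

theorem contDiffOn_normalized {E : Type*} [NormedAddCommGroup E] [NormedSpace ℝ E]
    {f : E → Amb n} {s : Set E} (hf : ContDiffOn ℝ ∞ f s)
    (hpos : ∀ w ∈ s, 0 < ε * form ε (f w) (f w)) :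
    ContDiffOn ℝ ∞ (fun w => normalized ε (f w)) s := by
  have h1 : ContDiffOn ℝ ∞ (fun w => ε * form ε (f w) (f w)) s :=
    contDiffOn_const.mul (contDiffOn_form hf hf)
  exact ((h1.sqrt fun w hw => (hpos w hw).ne').inv
    fun w hw => (Real.sqrt_pos.mpr (hpos w hw)).ne').smul hf

/-- The vector that represents a linear functional with respect to the flat metric. -/
def raiseIndex (ε : ℝ) (l : Amb n →ₗ[ℝ] ℝ) : Amb n := fun i => eta ε i * l (Pi.single i 1)

theorem form_raiseIndex (hε : ε = 1 ∨ ε = -1) (l : Amb n →ₗ[ℝ] ℝ) (y : Amb n) :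
    form ε (raiseIndex ε l) y = l y := by
  have hy : l y = ∑ i, y i * l (Pi.single i 1) := by
    conv_lhs => rw [← Finset.univ_sum_single y, map_sum]
    refine Finset.sum_congr rfl fun i _ => ?_
    rw [← smul_eq_mul, ← map_smul, ← Pi.single_smul, smul_eq_mul, mul_one]
  rw [hy, form]
  refine Finset.sum_congr rfl fun i _ => ?_
  rw [raiseIndex, ← mul_assoc, eta_mul_self hε, one_mul, mul_comm]

/-- A smooth local parametrization `Φ` of a hypersurface of the space form on an open set `O`,
with a smooth unit normal field `N`. -/
structure LocalHypersurface (ε : ℝ) (O : Set (EuclideanSpace ℝ (Fin n)))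
    (Φ N : EuclideanSpace ℝ (Fin n) → Amb n) : Prop where
  isOpen : IsOpen O
  smooth : ContDiffOn ℝ ∞ Φ O
  smooth_normal : ContDiffOn ℝ ∞ N O
  mem : ∀ q ∈ O, Φ q ∈ SpaceForm n ε
  inj : ∀ q ∈ O, Function.Injective (fderiv ℝ Φ q)
  base_normal : ∀ q ∈ O, form ε (Φ q) (N q) = 0
  normal : ∀ q ∈ O, ∀ X, form ε (N q) (fderiv ℝ Φ q X) = 0
  unit : ∀ q ∈ O, form ε (N q) (N q) = ε

variable {O : Set (EuclideanSpace ℝ (Fin n))} {Φ N : EuclideanSpace ℝ (Fin n) → Amb n}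

theorem LocalHypersurface.hasFDerivAt (h : LocalHypersurface ε O Φ N)
    {q : EuclideanSpace ℝ (Fin n)} (hq : q ∈ O) : HasFDerivAt Φ (fderiv ℝ Φ q) q :=
  ((h.smooth.contDiffAt (h.isOpen.mem_nhds hq)).differentiableAt (by simp)).hasFDerivAt

theorem LocalHypersurface.hasFDerivAt_normal (h : LocalHypersurface ε O Φ N)
    {q : EuclideanSpace ℝ (Fin n)} (hq : q ∈ O) : HasFDerivAt N (fderiv ℝ N q) q :=
  ((h.smooth_normal.contDiffAt (h.isOpen.mem_nhds hq)).differentiableAt (by simp)).hasFDerivAt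

theorem tangent_of_mem_spaceForm {q : EuclideanSpace ℝ (Fin n)} (ho : IsOpen O) (hq : q ∈ O)
    (hd : DifferentiableAt ℝ Φ q) (hmem : ∀ q ∈ O, Φ q ∈ SpaceForm n ε)
    (X : EuclideanSpace ℝ (Fin n)) : form ε (Φ q) (fderiv ℝ Φ q X) = 0 := by
  have := form_hasFDerivAt_add_eq_zero (ε := ε) (c := 1) hd.hasFDerivAt hd.hasFDerivAt
    (Filter.eventually_of_mem (ho.mem_nhds hq) fun w hw => (hmem w hw).1) X
  rw [form_comm (fderiv ℝ Φ q X)] at this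
  linarith

theorem LocalHypersurface.jet (h : LocalHypersurface ε O Φ N)
    {q : EuclideanSpace ℝ (Fin n)} (hq : q ∈ O) :
    HypersurfaceJet ε (Φ q) (N q) (fderiv ℝ Φ q) (fderiv ℝ N q) where
  mem := h.mem q hq
  inj := h.inj q hq
  tangent := tangent_of_mem_spaceForm h.isOpen hq (h.hasFDerivAt hq).differentiableAt h.mem
  base_normal := h.base_normal q hq
  normal := h.normal q hq
  unit := h.unit q hq
  base_shape X := by
    have := form_hasFDerivAt_add_eq_zero (h.hasFDerivAt hq) (h.hasFDerivAt_normal hq)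
      (Filter.eventually_of_mem (h.isOpen.mem_nhds hq) h.base_normal) X
    rwa [form_comm, h.normal q hq, zero_add] at this
  normal_shape X := by
    have := form_hasFDerivAt_add_eq_zero (h.hasFDerivAt_normal hq) (h.hasFDerivAt_normal hq)
      (Filter.eventually_of_mem (h.isOpen.mem_nhds hq) h.unit) X
    rw [form_comm (fderiv ℝ N q X)] at this
    linarith

/-- First order data of a local parametrization of the unit tangent bundle. -/
theorem LocalHypersurface.unitTangentJet (h : LocalHypersurface ε O Φ N)
    {q : Par n → EuclideanSpace ℝ (Fin n)} {v : Par n → Amb n} {u : Par n} (hq : q u ∈ O)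
    (hdq : DifferentiableAt ℝ q u) (hdv : DifferentiableAt ℝ v u)
    (hv : ∀ᶠ w in nhds u, v w ∈ Set.range (fderiv ℝ Φ (q w)) ∧ form ε (v w) (v w) = ε)
    (hinj : Function.Injective (fderiv ℝ (fun w => (Φ (q w), v w)) u)) :
    UnitTangentJet ε (Φ (q u)) (N (q u)) (fderiv ℝ Φ (q u)) (fderiv ℝ N (q u)) (v u)
      (fderiv ℝ q u) (fderiv ℝ v u) := by
  have hO : ∀ᶠ w in nhds u, q w ∈ O := hdq.continuousAt (h.isOpen.mem_nhds hq)
  have hΦ : HasFDerivAt (fun w => Φ (q w)) _ u := (h.hasFDerivAt hq).comp u hdq.hasFDerivAt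
  have hN : HasFDerivAt (fun w => N (q w)) _ u := (h.hasFDerivAt_normal hq).comp u hdq.hasFDerivAt
  refine ⟨hv.self_of_nhds.1, hv.self_of_nhds.2, fun e => ?_, fun e => ?_, fun e => ?_,
    fun e h1 h2 => ?_⟩
  · have := form_hasFDerivAt_add_eq_zero (ε := ε) (c := 0) hΦ hdv.hasFDerivAt (by
      filter_upwards [hO, hv] with w hw hvw
      obtain ⟨X, hX⟩ := hvw.1
      rw [← hX, (h.jet hw).tangent]) e
    simp only [ContinuousLinearMap.comp_apply] at this
    linarith
  · have := form_hasFDerivAt_add_eq_zero (ε := ε) hdv.hasFDerivAt hdv.hasFDerivAt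
      (hv.mono fun w hw => hw.2) e
    rw [form_comm (fderiv ℝ v u e)] at this
    linarith
  · have := form_hasFDerivAt_add_eq_zero (ε := ε) (c := 0) hN hdv.hasFDerivAt (by
      filter_upwards [hO, hv] with w hw hvw
      obtain ⟨X, hX⟩ := hvw.1
      rw [← hX, (h.jet hw).normal]) e
    simp only [ContinuousLinearMap.comp_apply] at this
    linarith
  · apply hinj
    rw [(hΦ.prodMk hdv.hasFDerivAt).fderiv, map_zero]
    simp [h1, h2]

theorem LocalHypersurface.fderiv_wedge (h : LocalHypersurface ε O Φ N)
    {q : Par n → EuclideanSpace ℝ (Fin n)} {v : Par n → Amb n} {u : Par n} (hq : q u ∈ O)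
    (hdq : DifferentiableAt ℝ q u) (hdv : DifferentiableAt ℝ v u) (e : Par n) :
    fderiv ℝ (fun w => wedge (Φ (q w)) (v w)) u e
      = wedge (fderiv ℝ Φ (q u) (fderiv ℝ q u e)) (v u) + wedge (Φ (q u)) (fderiv ℝ v u e) :=
  (wedge_hasFDerivAt ((h.hasFDerivAt hq).comp u hdq.hasFDerivAt) hdv.hasFDerivAt).2 e

/-- An immersed hypersurface has a smooth unit normal field near each point. The normal direction is
represented by a coordinate functional of the moving basis that consists of the position vector,
the tangent vectors, and a fixed transversal vector. -/
theorem exists_localHypersurface (hε : ε = 1 ∨ ε = -1) {T : Set (EuclideanSpace ℝ (Fin n))}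
    (hT : IsOpen T) (hΦ : ContDiffOn ℝ ∞ Φ T) (hmem : ∀ q ∈ T, Φ q ∈ SpaceForm n ε)
    (hinj : ∀ q ∈ T, Function.Injective (fderiv ℝ Φ q)) {q₀ : EuclideanSpace ℝ (Fin n)}
    (hq₀ : q₀ ∈ T) :
    ∃ O ⊆ T, q₀ ∈ O ∧ ∃ N : EuclideanSpace ℝ (Fin n) → Amb n, LocalHypersurface ε O Φ N := by
  have hd : ∀ q ∈ T, DifferentiableAt ℝ Φ q := fun q hq =>
    (hΦ.contDiffAt (hT.mem_nhds hq)).differentiableAt (by simp)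
  have htan : ∀ q ∈ T, ∀ X, form ε (Φ q) (fderiv ℝ Φ q X) = 0 := fun q hq =>
    tangent_of_mem_spaceForm hT hq (hd q hq) hmem
  let P : EuclideanSpace ℝ (Fin n) → (ℝ × EuclideanSpace ℝ (Fin n) →L[ℝ] Amb n) := fun q =>
    (ContinuousLinearMap.fst ℝ ℝ _).smulRight (Φ q)
      + (fderiv ℝ Φ q).comp (ContinuousLinearMap.snd ℝ ℝ _)
  have hP : ∀ q s X, P q (s, X) = s • Φ q + fderiv ℝ Φ q X := fun q s X => rfl
  obtain ⟨m, hm⟩ : ∃ m, m ∉ LinearMap.range (P q₀).toLinearMap := by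
    by_contra! hall
    have htop : LinearMap.range (P q₀).toLinearMap = ⊤ := eq_top_iff.mpr fun m _ => hall m
    have h1 := LinearMap.finrank_range_le (P q₀).toLinearMap
    rw [htop, finrank_top] at h1
    simp only [Module.finrank_prod, Module.finrank_self, finrank_euclideanSpace,
      Fintype.card_fin, Module.finrank_fintype_fun_eq_card] at h1
    omega
  let B : EuclideanSpace ℝ (Fin n) → ((ℝ × EuclideanSpace ℝ (Fin n)) × ℝ →L[ℝ] Amb n) := fun q =>
    (P q).comp (ContinuousLinearMap.fst ℝ _ ℝ) + (ContinuousLinearMap.snd ℝ _ ℝ).smulRight m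
  have hB : ∀ q (s : ℝ) (X : EuclideanSpace ℝ (Fin n)) (t : ℝ), B q ((s, X), t)
      = s • Φ q + fderiv ℝ Φ q X + t • m := fun q s X t => rfl
  have hdΦ : ContDiffOn ℝ ∞ (fderiv ℝ Φ) T := hΦ.fderiv_of_isOpen hT (by simp)
  have hBs : ContDiffOn ℝ ∞ B T := by
    have h1 : ContDiffOn ℝ ∞ P T :=
      (contDiffOn_const.smulRight hΦ).add (hdΦ.clm_comp contDiffOn_const)
    exact (h1.clm_comp contDiffOn_const).add contDiffOn_const
  have hB0 : (B q₀).IsInvertible := by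
    have hi : Function.Injective (B q₀).toLinearMap := by
      rw [← LinearMap.ker_eq_bot, LinearMap.ker_eq_bot']
      rintro ⟨⟨s, X⟩, t⟩ h0
      change B q₀ ((s, X), t) = 0 at h0
      rw [hB] at h0
      have ht : t = 0 := by
        by_contra ht
        refine hm ⟨((-t⁻¹) • (s, X)), ?_⟩
        have h1 : P q₀ (s, X) = -(t • m) := by rw [hP]; exact eq_neg_of_add_eq_zero_left h0
        change P q₀ ((-t⁻¹) • (s, X)) = m
        rw [map_smul, h1, smul_neg, neg_smul, neg_neg, smul_smul, inv_mul_cancel₀ ht, one_smul]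
      subst ht
      have h1 := congrArg (form ε (Φ q₀)) h0
      simp only [form_add_right, form_smul_right, (hmem q₀ hq₀).1, htan q₀ hq₀, form_zero_right,
        zero_mul, add_zero, mul_one] at h1
      subst h1
      have hX : fderiv ℝ Φ q₀ X = fderiv ℝ Φ q₀ 0 := by simpa using h0
      rw [hinj q₀ hq₀ hX]; rfl
    refine ⟨(LinearEquiv.ofInjectiveOfFinrankEq (B q₀).toLinearMap hi (by
      simp only [Module.finrank_prod, Module.finrank_self, finrank_euclideanSpace,
        Fintype.card_fin, Module.finrank_fintype_fun_eq_card]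
      omega)).toContinuousLinearEquiv, ?_⟩
    exact ContinuousLinearMap.ext fun x => rfl
  let O := T ∩ B ⁻¹' {f | f.IsInvertible}
  have hO : IsOpen O := hBs.continuousOn.isOpen_inter_preimage hT ContinuousLinearEquiv.isOpen
  let l : EuclideanSpace ℝ (Fin n) → (Amb n →L[ℝ] ℝ) := fun q =>
    (ContinuousLinearMap.snd ℝ _ ℝ).comp (B q).inverse
  have hlB : ∀ q ∈ O, ∀ (s : ℝ) (X : EuclideanSpace ℝ (Fin n)) (t : ℝ),
      l q (s • Φ q + fderiv ℝ Φ q X + t • m) = t := by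
    rintro q ⟨-, g, hg⟩ s X t
    change ((B q).inverse _).2 = t
    rw [← hB, ← hg, ContinuousLinearMap.inverse_equiv]
    simp
  have hls : ContDiffOn ℝ ∞ l O := by
    refine contDiffOn_const.clm_comp fun q hq => ?_
    exact (hq.2.contDiffAt_map_inverse.comp_contDiffWithinAt q
      ((hBs q hq.1).mono Set.inter_subset_left))
  let N₀ : EuclideanSpace ℝ (Fin n) → Amb n := fun q => raiseIndex ε (l q).toLinearMap
  have hN₀ : ∀ q y, form ε (N₀ q) y = l q y := fun q y => form_raiseIndex hε _ y
  have hN₀p : ∀ q ∈ O, form ε (Φ q) (N₀ q) = 0 := fun q hq => by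
    rw [form_comm, hN₀]; simpa using hlB q hq 1 0 0
  have hN₀D : ∀ q ∈ O, ∀ X, form ε (N₀ q) (fderiv ℝ Φ q X) = 0 := fun q hq X => by
    rw [hN₀]; simpa using hlB q hq 0 X 0
  have hpos : ∀ q ∈ O, 0 < ε * form ε (N₀ q) (N₀ q) := fun q hq => by
    refine form_self_pos hε (hmem q hq.1).1 (hN₀p q hq) fun h0 => ?_
    have h1 : form ε (N₀ q) m = 1 := by rw [hN₀]; simpa using hlB q hq 0 0 1
    rw [h0, form_zero_left] at h1
    exact zero_ne_one h1
  have hN₀s : ContDiffOn ℝ ∞ N₀ O := contDiffOn_pi.mpr fun i =>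
    contDiffOn_const.mul (hls.clm_apply contDiffOn_const)
  refine ⟨O, Set.inter_subset_left, ⟨hq₀, hB0⟩, fun q => normalized ε (N₀ q), hO,
    hΦ.mono Set.inter_subset_left, contDiffOn_normalized hN₀s hpos, fun q hq => hmem q hq.1,
    fun q hq => hinj q hq.1, fun q hq => ?_, fun q hq X => ?_,
    fun q hq => form_normalized hε (hpos q hq)⟩
  · rw [normalized, form_smul_right, hN₀p q hq, mul_zero]
  · rw [normalized, form_smul_left, hN₀D q hq, mul_zero]

end LocalHypersurface

/-! ### Hypersurfaces in charts -/

section Charts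

variable {n : ℕ} {M : Type*} [TopologicalSpace M] [ChartedSpace (EuclideanSpace ℝ (Fin n)) M]
  {ε : ℝ} {φ : M → Amb n}

/-- The map `φ` in the chart at `x`. -/
abbrev localRep (φ : M → Amb n) (x : M) : EuclideanSpace ℝ (Fin n) → Amb n :=
  φ ∘ (extChartAt 𝓘(ℝ, EuclideanSpace ℝ (Fin n)) x).symm

theorem dphi_eq (hφ : IsImmersedHypersurface ε φ) (x : M) (X : EuclideanSpace ℝ (Fin n)) :
    dphi φ x X
      = fderiv ℝ (localRep φ x) (extChartAt 𝓘(ℝ, EuclideanSpace ℝ (Fin n)) x x) X := by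
  have hd : MDifferentiableAt 𝓘(ℝ, EuclideanSpace ℝ (Fin n)) 𝓘(ℝ, Amb n) φ x :=
    (hφ.smooth x).mdifferentiableAt (by simp)
  have h1 : (mfderiv 𝓘(ℝ, EuclideanSpace ℝ (Fin n)) 𝓘(ℝ, Amb n) φ x :
      EuclideanSpace ℝ (Fin n) →L[ℝ] Amb n) = fderivWithin ℝ (localRep φ x)
        (Set.range 𝓘(ℝ, EuclideanSpace ℝ (Fin n)))
        (extChartAt 𝓘(ℝ, EuclideanSpace ℝ (Fin n)) x x) := hd.mfderiv
  rw [ModelWithCorners.range_eq_univ, fderivWithin_univ] at h1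
  exact congrArg (fun L : EuclideanSpace ℝ (Fin n) →L[ℝ] Amb n => L X) h1

variable [IsManifold 𝓘(ℝ, EuclideanSpace ℝ (Fin n)) ∞ M]

theorem localRep_contDiffOn (hφ : IsImmersedHypersurface ε φ) (x : M) :
    ContDiffOn ℝ ∞ (localRep φ x) (extChartAt 𝓘(ℝ, EuclideanSpace ℝ (Fin n)) x).target :=
  (hφ.smooth.comp_contMDiffOn (contMDiffOn_extChartAt_symm x)).contDiffOn

/-- The differential of a hypersurface and its second fundamental form in terms of another chart.
The second fundamental form becomes the derivative of a normal field, which needs only the first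
derivative `T` of the change of charts. -/
theorem exists_transition (hφ : IsImmersedHypersurface ε φ) {x₀ x : M}
    (hx : x ∈ (extChartAt 𝓘(ℝ, EuclideanSpace ℝ (Fin n)) x₀).source) :
    ∃ T : EuclideanSpace ℝ (Fin n) →L[ℝ] EuclideanSpace ℝ (Fin n), Function.Bijective T ∧
      (∀ X, dphi φ x X = fderiv ℝ (localRep φ x₀)
        (extChartAt 𝓘(ℝ, EuclideanSpace ℝ (Fin n)) x₀ x) (T X)) ∧
      ∀ O N, LocalHypersurface ε O (localRep φ x₀) N →
        extChartAt 𝓘(ℝ, EuclideanSpace ℝ (Fin n)) x₀ x ∈ O → ∀ X Y,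
        secondForm ε φ x (N (extChartAt 𝓘(ℝ, EuclideanSpace ℝ (Fin n)) x₀ x)) X Y
          = -(ε * form ε (fderiv ℝ N (extChartAt 𝓘(ℝ, EuclideanSpace ℝ (Fin n)) x₀ x) (T X))
            (dphi φ x Y)) := by
  set ψ₀ := extChartAt 𝓘(ℝ, EuclideanSpace ℝ (Fin n)) x₀
  set ψ := extChartAt 𝓘(ℝ, EuclideanSpace ℝ (Fin n)) x with hψ
  let τ := ψ₀ ∘ ψ.symm
  have hτx : τ (ψ x) = ψ₀ x := congrArg ψ₀ (extChartAt_to_inv x)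
  have hsymm : ContinuousAt ψ.symm (ψ x) := continuousAt_extChartAt_symm x
  have hsrc : ∀ᶠ r in nhds (ψ x), r ∈ ψ.target ∧ ψ.symm r ∈ ψ₀.source := by
    refine Filter.Eventually.and (extChartAt_target_mem_nhds x) (hsymm ?_)
    rw [extChartAt_to_inv]
    exact (isOpen_extChartAt_source x₀).mem_nhds hx
  have hτd : ∀ᶠ r in nhds (ψ x), DifferentiableAt ℝ τ r := by
    filter_upwards [hsrc.eventually_nhds] with r hr
    have hnhds : (ψ.symm ≫ ψ₀).source ∈ nhds r := hr
    exact ((contDiffOn_ext_coord_change (I := 𝓘(ℝ, EuclideanSpace ℝ (Fin n))) (n := ∞) x₀ x).contDiffAt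
      hnhds).differentiableAt (by simp)
  have hrep : ∀ᶠ r in nhds (ψ x), localRep φ x r = localRep φ x₀ (τ r) := by
    filter_upwards [hsrc] with r hr
    exact congrArg φ (ψ₀.left_inv hr.2).symm
  have hΦd : ∀ᶠ r in nhds (ψ x), DifferentiableAt ℝ (localRep φ x₀) (τ r) := by
    filter_upwards [hsrc] with r hr
    exact ((localRep_contDiffOn hφ x₀).contDiffAt
      ((isOpen_extChartAt_target x₀).mem_nhds (ψ₀.map_source hr.2))).differentiableAt (by simp)
  have hchain : ∀ᶠ r in nhds (ψ x), fderiv ℝ (localRep φ x) r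
      = (fderiv ℝ (localRep φ x₀) (τ r)).comp (fderiv ℝ τ r) := by
    filter_upwards [hrep.eventually_nhds, hτd, hΦd] with r h1 h2 h3
    rw [Filter.EventuallyEq.fderiv_eq h1]
    exact fderiv_comp r h3 h2
  have hdphi : ∀ X, dphi φ x X = fderiv ℝ (localRep φ x₀) (ψ₀ x) (fderiv ℝ τ (ψ x) X) := by
    intro X
    rw [dphi_eq hφ, ← hψ, hchain.self_of_nhds, hτx]; rfl
  have hTinj : Function.Injective (fderiv ℝ τ (ψ x)) := fun X Y hXY =>
    hφ.immersion x (show dphi φ x X = dphi φ x Y by rw [hdphi, hdphi, hXY])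
  refine ⟨fderiv ℝ τ (ψ x), ⟨hTinj, (LinearMap.injective_iff_surjective
    (f := (fderiv ℝ τ (ψ x)).toLinearMap)).mp hTinj⟩, hdphi, fun O N h hO X Y => ?_⟩
  have hG : HasFDerivAt (fderiv ℝ (localRep φ x)) (fderiv ℝ (fderiv ℝ (localRep φ x)) (ψ x))
      (ψ x) := by
    have h1 := (localRep_contDiffOn hφ x).contDiffAt (extChartAt_target_mem_nhds x)
    exact ((h1.fderiv_right (m := 1) (by norm_cast)).differentiableAt (by simp)).hasFDerivAt
  have hGY := hG.clm_apply (hasFDerivAt_const Y (ψ x))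
  have hNτ : HasFDerivAt (fun r => N (τ r)) _ (ψ x) :=
    (by rw [hτx]; exact h.hasFDerivAt_normal hO : HasFDerivAt N (fderiv ℝ N (ψ₀ x)) (τ (ψ x))).comp
      (ψ x) hτd.self_of_nhds.hasFDerivAt
  have hmem : ∀ᶠ r in nhds (ψ x), τ r ∈ O :=
    hτd.self_of_nhds.continuousAt (by rw [hτx]; exact h.isOpen.mem_nhds hO)
  have key := form_hasFDerivAt_add_eq_zero (ε := ε) (c := 0) hGY hNτ (by
    filter_upwards [hchain, hmem] with r h1 h2
    rw [h1, form_comm]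
    exact h.normal _ h2 _) X
  simp only [ContinuousLinearMap.comp_zero, zero_add, ContinuousLinearMap.flip_apply,
    ContinuousLinearMap.comp_apply, hτx] at key
  rw [secondForm, form_comm (fderiv ℝ N (ψ₀ x) _), dphi_eq hφ]
  linear_combination ε * key

theorem range_dphi (hφ : IsImmersedHypersurface ε φ) {x₀ x : M}
    (hx : x ∈ (extChartAt 𝓘(ℝ, EuclideanSpace ℝ (Fin n)) x₀).source) :
    Set.range (dphi φ x) = Set.range (fderiv ℝ (localRep φ x₀)
      (extChartAt 𝓘(ℝ, EuclideanSpace ℝ (Fin n)) x₀ x)) := by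
  obtain ⟨T, hT, hd, -⟩ := exists_transition hφ hx
  rw [show dphi φ x = _ ∘ T from funext hd, hT.surjective.range_comp]

theorem localRep_fderiv_injective (hφ : IsImmersedHypersurface ε φ) {x₀ : M}
    {q : EuclideanSpace ℝ (Fin n)}
    (hq : q ∈ (extChartAt 𝓘(ℝ, EuclideanSpace ℝ (Fin n)) x₀).target) :
    Function.Injective (fderiv ℝ (localRep φ x₀) q) := by
  set ψ₀ := extChartAt 𝓘(ℝ, EuclideanSpace ℝ (Fin n)) x₀
  obtain ⟨T, hT, hd, -⟩ := exists_transition hφ (ψ₀.map_target hq)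
  rw [ψ₀.right_inv hq] at hd
  refine (Function.Injective.of_comp_iff' _ hT).mp fun X Y hXY => hφ.immersion (ψ₀.symm q) ?_
  have h1 : dphi φ (ψ₀.symm q) X = dphi φ (ψ₀.symm q) Y := by rw [hd, hd]; exact hXY
  exact h1

/-- In the chart at `x₀`, an immersed hypersurface has a smooth unit normal field near `x₀`. -/
theorem exists_localHypersurface_localRep (hε : ε = 1 ∨ ε = -1)
    (hφ : IsImmersedHypersurface ε φ) (x₀ : M) :
    ∃ O ⊆ (extChartAt 𝓘(ℝ, EuclideanSpace ℝ (Fin n)) x₀).target,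
      extChartAt 𝓘(ℝ, EuclideanSpace ℝ (Fin n)) x₀ x₀ ∈ O ∧
      ∃ N, LocalHypersurface ε O (localRep φ x₀) N :=
  exists_localHypersurface hε (isOpen_extChartAt_target x₀) (localRep_contDiffOn hφ x₀)
    (fun _ _ => hφ.mem _) (fun _ hq => localRep_fderiv_injective hφ hq)
    (mem_extChartAt_target x₀)

end Charts

/-! ### The Hopf condition at a point -/

section HopfPoint

variable {n : ℕ} {ε : ℝ} {p N v : Amb n} {D S : EuclideanSpace ℝ (Fin n) →L[ℝ] Amb n}
  {L : Par n →L[ℝ] EuclideanSpace ℝ (Fin n)} {V : Par n →L[ℝ] Amb n}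
  {F' ν' : Par n →L[ℝ] Biv n}

theorem bivForm_sub_left (A B C : Biv n) :
    bivForm ε (A - B) C = bivForm ε A C - bivForm ε B C := by
  simp only [← bivFormL_apply, map_sub, sub_apply]

/-- If the structure vector of the tangent hypersurface at `p ∧ v` is a principal direction, for a
unit normal field with value `β v ∧ N` and derivative `ν'`, then the shape operator of the given
hypersurface maps `v` to a multiple of itself. -/
theorem UnitTangentJet.form_shape_eq_zero (hε : ε = 1 ∨ ε = -1) (h : HypersurfaceJet ε p N D S)
    (hv : UnitTangentJet ε p N D S v L V)
    (hF : ∀ e, F' e = wedge (D (L e)) v + wedge p (V e)) (hinj : Function.Injective F')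
    {β : ℝ} (hβ : β ≠ 0) {γ : Par n → ℝ}
    (hν : ∀ e, ν' e = β • (wedge (V e) N + wedge v (S (L e))) + γ e • wedge v N)
    {κ : ℝ} {X : Par n} (hX : F' X = -structJ ε (wedge p v) (β • wedge v N))
    (hpart : IsTangentialPart ε (wedge p v) (ν' X)
      (-(κ • -structJ ε (wedge p v) (β • wedge v N))))
    {ζ Y : EuclideanSpace ℝ (Fin n)} (hζ : D ζ = v) (hY : form ε v (D Y) = 0) :
    form ε (S ζ) (D Y) = 0 := by
  have hε0 : ε ≠ 0 := by rcases hε with rfl | rfl <;> norm_num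
  have hfr := hv.frame h
  have hNv : form ε N v = 0 := by rw [← hζ, h.normal]
  have hk := (hv.injective_iff hε h hF hζ).mp hinj
  obtain ⟨e, he1, he2, he3⟩ := hv.exists_geodesic_direction hε h hF hζ
  rw [structJ_smul, hv.structJ_wedge_normal h] at hX hpart
  have hXe : X = (-(β / form ε (S ζ) v)) • e := by
    refine hinj ?_
    rw [hX, map_smul, he3, smul_smul, ← smul_neg, neg_neg, smul_smul]
    congr 1
    field_simp
  have hZ : wedge v (D Y) ∈ geodesicTangent ε (wedge p v) :=
    (mem_geodesicTangent_iff hε hfr).mpr ⟨0, D Y, form_zero_right _, form_zero_right _,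
      h.tangent Y, hY, by rw [wedge_zero_right, zero_add]⟩
  have h1 := hpart.2 _ hZ
  have hW : -(κ • -(β • -(ε • wedge p N))) = (-(κ * β * ε)) • wedge p N := by module
  rw [bivForm_sub_left, hW, bivForm_smul_left, bivForm_wedge, h.normal, h.tangent, hXe, map_smul,
    bivForm_smul_left, hν, he1, bivForm_add_left, bivForm_smul_left, bivForm_smul_left,
    bivForm_add_left, bivForm_wedge, bivForm_wedge, bivForm_wedge, h.normal, hY, hNv,
    hv.unit] at h1
  have h2 : β / form ε (S ζ) v * (β * (ε * form ε (S ζ) (D Y))) = 0 := by linarith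
  simpa [hβ, hk, hε0] using h2

/-- At a point where the shape operator of the given hypersurface is `l` times the identity with
`l ≠ 0`, the structure vector of the tangent hypersurface is a principal direction, with principal
curvature `ε / l`. -/
theorem UnitTangentJet.exists_principal (hε : ε = 1 ∨ ε = -1) (h : HypersurfaceJet ε p N D S)
    (hv : UnitTangentJet ε p N D S v L V)
    (hF : ∀ e, F' e = wedge (D (L e)) v + wedge p (V e)) {l : ℝ} (hl : l ≠ 0)
    (hS : ∀ X, S X = -(l • D X))
    (hν : ∀ e, ν' e = wedge (V e) N + wedge v (S (L e))) :
    ∃ (κ : ℝ) (X : Par n), F' X = -structJ ε (wedge p v) (wedge v N) ∧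
      IsTangentialPart ε (wedge p v) (ν' X) (-(κ • -structJ ε (wedge p v) (wedge v N))) := by
  have hs := curvature_mul_self hε
  obtain ⟨ζ, hζ⟩ := hv.range
  obtain ⟨e, he1, he2, he3⟩ := hv.exists_geodesic_direction hε h hF hζ
  have hk : ε * form ε (S ζ) v = -l := by
    rw [hS, hζ, form_neg_left, form_smul_left, hv.unit]; linear_combination (-l) * hs
  have hνe : ν' e = (-ε) • wedge p N := by
    have h1 : -(ε • p) - (ε * form ε (S ζ) v) • N = (-ε) • p + l • N := by rw [hk]; module
    have h2 : -(l • v) = (-l) • v := by module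
    rw [hν, he1, he2, h1, hS, hζ, wedge_add_left, wedge_smul_left, wedge_smul_left, wedge_self,
      h2, wedge_smul_right, wedge_self, smul_zero, smul_zero, add_zero, add_zero]
  rw [hv.structJ_wedge_normal h]
  refine ⟨ε / l, (ε / l) • e, ?_, ?_⟩
  · rw [map_smul, he3, hk, neg_neg, neg_neg, smul_smul, div_mul_cancel₀ _ hl]
  · have hW : -((ε / l) • - -(ε • wedge p N)) = (-(ε / l * ε)) • wedge p N := by module
    rw [hW]
    constructor
    · refine (mem_geodesicTangent_iff hε (hv.frame h)).mpr ⟨(-(ε / l * ε)) • N, 0, ?_, ?_,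
        form_zero_right _, form_zero_right _, ?_⟩
      · rw [form_smul_right, h.base_normal, mul_zero]
      · rw [form_smul_right, ← hζ, form_comm, h.normal, mul_zero]
      · rw [wedge_smul_right, wedge_zero_right, add_zero]
    · intro Z _
      rw [map_smul, hνe, bivForm_sub_left, bivForm_smul_left, bivForm_smul_left,
        bivForm_smul_left]
      ring

end HopfPoint

/-- A bilinear form that vanishes on all orthogonal pairs of vectors is a multiple of the inner
product. -/
theorem exists_eq_mul_of_orthogonal {W : Type*} [AddCommGroup W] [Module ℝ W]
    (b g : W →ₗ[ℝ] W →ₗ[ℝ] ℝ) (hpos : ∀ X, X ≠ 0 → g X X ≠ 0)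
    (h : ∀ X Y, g X Y = 0 → b X Y = 0) : ∃ l : ℝ, ∀ X Y, b X Y = l * g X Y := by
  by_cases hW : ∃ X : W, X ≠ 0
  swap
  · push Not at hW
    exact ⟨0, fun X Y => by rw [hW X]; simp⟩
  obtain ⟨A, hA⟩ := hW
  have hgA := hpos A hA
  refine ⟨b A A / g A A, ?_⟩
  set l := b A A / g A A
  let c : W → W → ℝ := fun X Y => b X Y - l * g X Y
  have hc : ∀ X Y, g X Y = 0 → c X Y = 0 := fun X Y hXY => by
    simp only [c, h X Y hXY, hXY, mul_zero, sub_zero]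
  have hadd : ∀ X X' Y, c (X + X') Y = c X Y + c X' Y := fun X X' Y => by
    simp only [c, map_add, LinearMap.add_apply]; ring
  have hcAA : c A A = 0 := by simp only [c, l]; field_simp; ring
  have hcA : ∀ Y, c A Y = 0 := fun Y => by
    have h1 := hc A (Y - (g A Y / g A A) • A) (by
      simp only [map_sub, map_smul, smul_eq_mul]; field_simp; ring)
    have h2 : c A (Y - (g A Y / g A A) • A) = c A Y - g A Y / g A A * c A A := by
      simp only [c, map_sub, map_smul, smul_eq_mul]; ring
    rw [h2, hcAA] at h1; linarith
  have hcA' : ∀ X, c X A = 0 := fun X => by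
    have h1 := hc (X - (g X A / g A A) • A) A (by
      simp only [map_sub, map_smul, LinearMap.sub_apply, LinearMap.smul_apply, smul_eq_mul]
      field_simp; ring)
    have h2 : c (X - (g X A / g A A) • A) A = c X A - g X A / g A A * c A A := by
      simp only [c, map_sub, map_smul, LinearMap.sub_apply, LinearMap.smul_apply, smul_eq_mul]
      ring
    rw [h2, hcAA] at h1; linarith
  -- `c X · = μ g X ·` with a number `μ` that depends on `X`; evaluation at `A` gives `μ = 0`
  have hne : ∀ X, g X A ≠ 0 → ∀ Y, c X Y = 0 := fun X hXA Y => by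
    have hX : X ≠ 0 := by rintro rfl; simp at hXA
    have hgX := hpos X hX
    have hμ : ∀ Z, c X Z = g X Z / g X X * c X X := fun Z => by
      have h1 := hc X (Z - (g X Z / g X X) • X) (by
        simp only [map_sub, map_smul, smul_eq_mul]; field_simp; ring)
      have h2 : c X (Z - (g X Z / g X X) • X) = c X Z - g X Z / g X X * c X X := by
        simp only [c, map_sub, map_smul, smul_eq_mul]; ring
      rw [h2] at h1; linarith
    have h0 := hμ A
    rw [hcA'] at h0
    have hXX : c X X = 0 := by
      have := (mul_eq_zero.mp h0.symm).resolve_left (div_ne_zero hXA hgX)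
      exact this
    rw [hμ, hXX, mul_zero]
  have hall : ∀ X Y, c X Y = 0 := fun X Y => by
    by_cases hXA : g X A = 0
    · have h1 := hne (X + A) (by rw [map_add, LinearMap.add_apply, hXA, zero_add]; exact hgA) Y
      rw [hadd, hcA] at h1; linarith
    · exact hne X hXA Y
  intro X Y
  have := hall X Y
  simp only [c] at this
  linarith

/-! ### Hopf tangent hypersurfaces come from umbilic hypersurfaces -/

section Forward

variable {n : ℕ} {M : Type*} [TopologicalSpace M] [ChartedSpace (EuclideanSpace ℝ (Fin n)) M]
  [IsManifold 𝓘(ℝ, EuclideanSpace ℝ (Fin n)) ∞ M] {ε : ℝ} {φ : M → Amb n}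

/-- In a chart of the hypersurface, any parametrization of the unit tangent bundle gives first order
data at all parameters near a given one. -/
theorem IsUnitTangentParam.eventually_jet (hφ : IsImmersedHypersurface ε φ) {x₀ : M}
    {O : Set (EuclideanSpace ℝ (Fin n))} {N : EuclideanSpace ℝ (Fin n) → Amb n}
    (h : LocalHypersurface ε O (localRep φ x₀) N)
    {U : Set (Par n)} {c : Par n → M} {v : Par n → Amb n} (hc : IsUnitTangentParam ε φ U c v)
    {u₀ : Par n} (hu₀ : u₀ ∈ U) (hx : c u₀ ∈ (extChartAt 𝓘(ℝ, EuclideanSpace ℝ (Fin n)) x₀).source)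
    (hO : extChartAt 𝓘(ℝ, EuclideanSpace ℝ (Fin n)) x₀ (c u₀) ∈ O) :
    ∃ q : Par n → EuclideanSpace ℝ (Fin n),
      q u₀ = extChartAt 𝓘(ℝ, EuclideanSpace ℝ (Fin n)) x₀ (c u₀) ∧
      ∀ᶠ u in nhds u₀, q u ∈ O ∧ φ (c u) = localRep φ x₀ (q u) ∧
        DifferentiableAt ℝ q u ∧ DifferentiableAt ℝ v u ∧
        UnitTangentJet ε (localRep φ x₀ (q u)) (N (q u)) (fderiv ℝ (localRep φ x₀) (q u))
          (fderiv ℝ N (q u)) (v u) (fderiv ℝ q u) (fderiv ℝ v u) ∧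
        ∀ e, fderiv ℝ (fun u => wedge (φ (c u)) (v u)) u e
          = wedge (fderiv ℝ (localRep φ x₀) (q u) (fderiv ℝ q u e)) (v u)
            + wedge (localRep φ x₀ (q u)) (fderiv ℝ v u e) := by
  set ψ := extChartAt 𝓘(ℝ, EuclideanSpace ℝ (Fin n)) x₀
  have hU : ∀ᶠ u in nhds u₀, u ∈ U := hc.isOpen.mem_nhds hu₀
  have hcc : ContinuousAt c u₀ := (hc.smooth_base.contMDiffAt (hc.isOpen.mem_nhds hu₀)).continuousAt
  have hsrc : ∀ᶠ u in nhds u₀, c u ∈ ψ.source :=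
    hcc ((isOpen_extChartAt_source x₀).mem_nhds hx)
  have hqd : ∀ u ∈ U, c u ∈ ψ.source → DifferentiableAt ℝ (fun u => ψ (c u)) u := by
    intro u hu hcu
    have h1 : ContMDiffAt 𝓘(ℝ, Par n) 𝓘(ℝ, EuclideanSpace ℝ (Fin n)) ∞ (fun u => ψ (c u)) u :=
      ContMDiffAt.comp u (contMDiffAt_extChartAt' (by rwa [← extChartAt_source
        (I := 𝓘(ℝ, EuclideanSpace ℝ (Fin n)))]))
        (hc.smooth_base.contMDiffAt (hc.isOpen.mem_nhds hu))
    exact h1.contDiffAt.differentiableAt (by simp)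
  have hqO : ∀ᶠ u in nhds u₀, ψ (c u) ∈ O :=
    (hqd u₀ hu₀ hx).continuousAt (h.isOpen.mem_nhds hO)
  refine ⟨fun u => ψ (c u), rfl, ?_⟩
  have hgood : ∀ᶠ u in nhds u₀, u ∈ U ∧ c u ∈ ψ.source ∧ ψ (c u) ∈ O :=
    hU.and (hsrc.and hqO)
  have hrep : ∀ u, c u ∈ ψ.source → φ (c u) = localRep φ x₀ (ψ (c u)) := fun u hu =>
    congrArg φ (ψ.left_inv hu).symm
  filter_upwards [hgood.eventually_nhds] with u hu
  obtain ⟨huU, husrc, huO⟩ := hu.self_of_nhds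
  have hdv : DifferentiableAt ℝ v u :=
    (hc.smooth_vec.contDiffAt (hc.isOpen.mem_nhds huU)).differentiableAt (by simp)
  have hdq := hqd u huU husrc
  refine ⟨huO, hrep u husrc, hdq, hdv, h.unitTangentJet huO hdq hdv ?_ ?_, fun e => ?_⟩
  · filter_upwards [hu] with w hw
    have h1 := hc.unitTangent w hw.1
    exact ⟨by rw [← range_dphi hφ hw.2.1]; exact h1.1, h1.2⟩
  · have h1 : (fun w => (φ (c w), v w)) =ᶠ[nhds u] fun w => (localRep φ x₀ (ψ (c w)), v w) := by
      filter_upwards [hu] with w hw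
      rw [hrep w hw.2.1]
    rw [← h1.fderiv_eq]
    exact hc.immersion u huU
  · have h1 : (fun w => wedge (φ (c w)) (v w)) =ᶠ[nhds u]
        fun w => wedge (localRep φ x₀ (ψ (c w))) (v w) := by
      filter_upwards [hu] with w hw
      rw [hrep w hw.2.1]
    rw [h1.fderiv_eq]
    exact h.fderiv_wedge (q := fun u => ψ (c u)) huO hdq hdv e

/-- If the tangent hypersurface is a Hopf hypersurface, every unit tangent vector is a principal
direction of the given hypersurface, with nonzero principal curvature. -/
theorem TangentHypersurfaceIsHopf.principal (hε : ε = 1 ∨ ε = -1)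
    (hφ : IsImmersedHypersurface ε φ) (hH : TangentHypersurfaceIsHopf ε φ) {x₀ : M}
    {O : Set (EuclideanSpace ℝ (Fin n))} {N : EuclideanSpace ℝ (Fin n) → Amb n}
    (h : LocalHypersurface ε O (localRep φ x₀) N) {q₀ : EuclideanSpace ℝ (Fin n)}
    (hq₀ : q₀ = extChartAt 𝓘(ℝ, EuclideanSpace ℝ (Fin n)) x₀ x₀) (hO : q₀ ∈ O)
    {ζ : EuclideanSpace ℝ (Fin n)}
    (hζ : form ε (fderiv ℝ (localRep φ x₀) q₀ ζ) (fderiv ℝ (localRep φ x₀) q₀ ζ) = ε) :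
    form ε (fderiv ℝ N q₀ ζ) (fderiv ℝ (localRep φ x₀) q₀ ζ) ≠ 0 ∧
    ∀ Y, form ε (fderiv ℝ (localRep φ x₀) q₀ ζ) (fderiv ℝ (localRep φ x₀) q₀ Y) = 0 →
      form ε (fderiv ℝ N q₀ ζ) (fderiv ℝ (localRep φ x₀) q₀ Y) = 0 := by
  have hv₀ : IsUnitTangent ε φ x₀ (fderiv ℝ (localRep φ x₀) q₀ ζ) := by
    refine ⟨?_, hζ⟩
    rw [range_dphi hφ (mem_extChartAt_source x₀), ← hq₀]
    exact ⟨ζ, rfl⟩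
  obtain ⟨U, c, v, hc, ⟨u₀, hu₀, hcu₀, hvu₀⟩, hpatch⟩ := hH x₀ _ hv₀
  obtain ⟨q, hqu₀, hev⟩ := hc.eventually_jet hφ h hu₀ (by rw [hcu₀]; exact mem_extChartAt_source x₀)
    (by rw [hcu₀, ← hq₀]; exact hO)
  rw [hcu₀, ← hq₀] at hqu₀
  obtain ⟨V, ν, hV, hu₀V, hVU, hνs, hν⟩ := hpatch.hopf u₀ hu₀
  -- the given unit normal field is a multiple of the explicit one
  have hνeq : ∀ᶠ u in nhds u₀,
      ν u = bivForm ε (ν u) (wedge (v u) (N (q u))) • wedge (v u) (N (q u)) := by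
    filter_upwards [hev, hV.mem_nhds hu₀V] with u hu huV
    obtain ⟨huO, hrep, -, -, hjet, hF⟩ := hu
    have h1 := (hν u huV).1
    have h2 := h1.tangent
    simp only [hrep] at h2
    exact hjet.eq_smul_wedge_normal hε (h.jet huO) hF (hpatch.immersion u (hVU huV)) h2 h1.normal
  obtain ⟨huO, hrep, hdq, hdv, hjet, hF⟩ := hev.self_of_nhds
  obtain ⟨hnormal, κ, X, hX, hpart⟩ := hν u₀ hu₀V
  have hinj := hpatch.immersion u₀ hu₀
  have hdν : DifferentiableAt ℝ ν u₀ :=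
    (hνs.contDiffAt (hV.mem_nhds hu₀V)).differentiableAt (by simp)
  have hdN := (h.hasFDerivAt_normal huO).comp u₀ hdq.hasFDerivAt
  obtain ⟨hdw, hdw'⟩ := wedge_hasFDerivAt hdv.hasFDerivAt hdN
  have hdβ : DifferentiableAt ℝ
      (fun u => bivForm ε (ν u) (wedge (v u) ((N ∘ q) u))) u₀ :=
    ((bivFormL n ε).hasFDerivAt_of_bilinear hdν.hasFDerivAt hdw.hasFDerivAt).differentiableAt
  have hν' := (hdβ.hasFDerivAt.smul hdw.hasFDerivAt).congr_of_eventuallyEq hνeq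
  have hνu₀ := hνeq.self_of_nhds
  set β := bivForm ε (ν u₀) (wedge (v u₀) (N (q u₀))) with hβdef
  have hβ : β ≠ 0 := by
    intro h0
    rw [h0, zero_smul] at hνu₀
    have h2 := hnormal.unit
    rw [hνu₀, ← bivFormL_apply, map_zero] at h2
    rcases h2 with h2 | h2 <;> norm_num at h2
  rw [hνu₀] at hX hpart
  beta_reduce at hX hpart
  rw [hrep] at hX hpart
  have hkey := fun ζ' Y => hjet.form_shape_eq_zero hε (h.jet huO) hF hinj hβ
    (ν' := fderiv ℝ ν u₀)
    (γ := fun e => fderiv ℝ (fun u => bivForm ε (ν u) (wedge (v u) ((N ∘ q) u))) u₀ e)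
    (fun e => by
      rw [hν'.fderiv]
      change β • fderiv ℝ (fun w => wedge (v w) ((N ∘ q) w)) u₀ e + (_ : ℝ) • wedge _ _ = _
      rw [hdw']; rfl) hX hpart (ζ := ζ') (Y := Y)
  have hne := hjet.injective_iff hε (h.jet huO) hF (ζ := ζ) (by rw [hqu₀, hvu₀])
  rw [hqu₀, hvu₀] at hne hkey
  exact ⟨hne.mp hinj, fun Y hY => hkey ζ Y rfl hY⟩

theorem TangentHypersurfaceIsHopf.umbilic_nonFlat (hn : 0 < n) (hε : ε = 1 ∨ ε = -1)
    (hφ : IsImmersedHypersurface ε φ) (hH : TangentHypersurfaceIsHopf ε φ) :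
    IsTotallyUmbilic ε φ ∧ IsNonFlat ε φ := by
  have hε0 : ε ≠ 0 := by rcases hε with rfl | rfl <;> norm_num
  have main : ∀ (x : M) (N₀ : Amb n), IsUnitNormalVector ε φ x N₀ →
      ∃ l : ℝ, l ≠ 0 ∧ ∀ X Y, secondForm ε φ x N₀ X Y = l * firstForm ε φ x X Y := by
    intro x N₀ hN₀
    obtain ⟨O, -, hO, N, h⟩ := exists_localHypersurface_localRep hε hφ x
    obtain ⟨T, hT, hd, h2⟩ := exists_transition hφ (mem_extChartAt_source x)
    have hsec := h2 O N h hO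
    clear h2
    have hp : φ x = localRep φ x (extChartAt 𝓘(ℝ, EuclideanSpace ℝ (Fin n)) x x) :=
      congrArg φ (extChartAt_to_inv x).symm
    obtain ⟨q₀, hq₀⟩ : ∃ q₀, q₀ = extChartAt 𝓘(ℝ, EuclideanSpace ℝ (Fin n)) x x := ⟨_, rfl⟩
    rw [← hq₀] at hd hsec hp hO
    have hjet := h.jet hO
    have hprin := fun ζ => hH.principal hε hφ h hq₀ hO (ζ := ζ)
    set D := fderiv ℝ (localRep φ x) q₀
    set S := fderiv ℝ N q₀
    have hpos : ∀ X, X ≠ 0 → 0 < ε * form ε (D X) (D X) := fun X hX =>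
      form_self_pos hε hjet.mem.1 (hjet.tangent X) fun h0 =>
        hX (hjet.inj (by rw [h0, map_zero]))
    let b : EuclideanSpace ℝ (Fin n) →ₗ[ℝ] EuclideanSpace ℝ (Fin n) →ₗ[ℝ] ℝ :=
      LinearMap.mk₂ ℝ (fun X Y => form ε (S X) (D Y))
        (fun _ _ _ => by rw [map_add, form_add_left])
        (fun _ _ _ => by rw [map_smul, form_smul_left, smul_eq_mul])
        (fun _ _ _ => by rw [map_add, form_add_right])
        (fun _ _ _ => by rw [map_smul, form_smul_right, smul_eq_mul])
    let g : EuclideanSpace ℝ (Fin n) →ₗ[ℝ] EuclideanSpace ℝ (Fin n) →ₗ[ℝ] ℝ :=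
      LinearMap.mk₂ ℝ (fun X Y => form ε (D X) (D Y))
        (fun _ _ _ => by rw [map_add, form_add_left])
        (fun _ _ _ => by rw [map_smul, form_smul_left, smul_eq_mul])
        (fun _ _ _ => by rw [map_add, form_add_right])
        (fun _ _ _ => by rw [map_smul, form_smul_right, smul_eq_mul])
    -- rescaling extends the properties of unit vectors to all vectors
    have hunit : ∀ X, X ≠ 0 → ∃ r : ℝ, r ≠ 0 ∧ form ε (D (r • X)) (D (r • X)) = ε :=
      fun X hX => ⟨(√(ε * form ε (D X) (D X)))⁻¹,
        inv_ne_zero (Real.sqrt_pos.mpr (hpos X hX)).ne', by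
        rw [map_smul]; exact form_normalized hε (hpos X hX)⟩
    have hb : ∀ X, X ≠ 0 → b X X ≠ 0 := by
      intro X hX hbX
      obtain ⟨r, hr, hrX⟩ := hunit X hX
      apply (hprin (r • X) hrX).1
      rw [map_smul, map_smul, form_smul_left, form_smul_right]
      change r * (r * b X X) = 0
      rw [hbX]; ring
    obtain ⟨m, hm⟩ := exists_eq_mul_of_orthogonal b g
      (fun X hX h0 => (hpos X hX).ne' (by
        change form ε (D X) (D X) = 0 at h0
        rw [h0, mul_zero])) (by
        intro X Y hXY
        by_cases hX : X = 0
        · rw [hX]; simp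
        obtain ⟨r, hr, hrX⟩ := hunit X hX
        have h3 := (hprin (r • X) hrX).2 Y (by
          rw [map_smul, form_smul_left]; exact mul_eq_zero_of_right _ hXY)
        rw [map_smul, form_smul_left] at h3
        exact (mul_eq_zero.mp h3).resolve_left hr)
    have hm0 : m ≠ 0 := by
      rintro rfl
      have : Nonempty (Fin n) := ⟨⟨0, hn⟩⟩
      obtain ⟨X, hX⟩ := exists_ne (0 : EuclideanSpace ℝ (Fin n))
      exact hb X hX (by rw [hm, zero_mul])
    -- `N₀` is a nonzero multiple of the unit normal field at this point
    obtain ⟨t, ht⟩ : ∃ t : ℝ, N₀ = t • N q₀ :=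
      ⟨_, hjet.eq_smul_normal hε (by rw [← hp]; exact hN₀.tangent) (fun X => by
        obtain ⟨X', rfl⟩ := hT.surjective X
        rw [← hd]; exact hN₀.normal X')⟩
    have ht0 : t ≠ 0 := by
      rintro rfl
      have h3 := hN₀.unit
      rw [ht, zero_smul, form_zero_left] at h3
      exact hε0 h3.symm
    refine ⟨-(t * m), neg_ne_zero.mpr (mul_ne_zero ht0 hm0), fun X Y => ?_⟩
    have h3 : secondForm ε φ x N₀ X Y = t * secondForm ε φ x (N q₀) X Y := by
      rw [secondForm, secondForm, ht, form_smul_right]; ring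
    have h4 : form ε (S (T X)) (D (T Y)) = m * form ε (D (T X)) (D (T Y)) := hm (T X) (T Y)
    rw [h3, hsec, firstForm, hd, hd, h4]
    ring
  refine ⟨fun x N₀ hN₀ => ?_, fun x N₀ hN₀ => ?_⟩
  · obtain ⟨l, -, hl⟩ := main x N₀ hN₀
    exact ⟨l, hl⟩
  · obtain ⟨l, hl0, hl⟩ := main x N₀ hN₀
    have : Nonempty (Fin n) := ⟨⟨0, hn⟩⟩
    obtain ⟨X, hX⟩ := exists_ne (0 : EuclideanSpace ℝ (Fin n))
    refine ⟨X, X, ?_⟩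
    rw [hl]
    have hp0 : form ε (φ x) (dphi φ x X) = 0 := by
      obtain ⟨O, -, hO, N, h⟩ := exists_localHypersurface_localRep hε hφ x
      have h1 := (h.jet hO).tangent X
      rw [← dphi_eq hφ] at h1
      rwa [show localRep φ x (extChartAt 𝓘(ℝ, EuclideanSpace ℝ (Fin n)) x x) = φ x from
        congrArg φ (extChartAt_to_inv x)] at h1
    have hX0 : dphi φ x X ≠ 0 := fun h0 => by
      have h1 : dphi φ x X = dphi φ x 0 := by rw [h0, dphi_eq hφ x 0, map_zero]
      exact hX (hφ.immersion x h1)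
    exact mul_ne_zero hl0 (form_self_pos hε (hφ.mem x).1 hp0 hX0).ne'

end Forward

/-! ### Umbilic hypersurfaces have Hopf tangent hypersurfaces -/

section Backward

variable {n : ℕ} {M : Type*} [TopologicalSpace M] [ChartedSpace (EuclideanSpace ℝ (Fin n)) M]
  [IsManifold 𝓘(ℝ, EuclideanSpace ℝ (Fin n)) ∞ M] {ε : ℝ} {φ : M → Amb n}

/-- For a totally umbilic hypersurface without flat points, the derivative of the unit normal field in
a chart is a nonzero multiple of the differential of the parametrization. -/
theorem exists_shape_eq (hε : ε = 1 ∨ ε = -1) (hφ : IsImmersedHypersurface ε φ)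
    (hum : IsTotallyUmbilic ε φ) (hnf : IsNonFlat ε φ) {x₀ : M}
    {O : Set (EuclideanSpace ℝ (Fin n))} {N : EuclideanSpace ℝ (Fin n) → Amb n}
    (h : LocalHypersurface ε O (localRep φ x₀) N) {q : EuclideanSpace ℝ (Fin n)} (hq : q ∈ O)
    (hqt : q ∈ (extChartAt 𝓘(ℝ, EuclideanSpace ℝ (Fin n)) x₀).target) :
    ∃ l : ℝ, l ≠ 0 ∧ ∀ X, fderiv ℝ N q X = -(l • fderiv ℝ (localRep φ x₀) q X) := by
  have hε0 : ε ≠ 0 := by rcases hε with rfl | rfl <;> norm_num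
  set ψ := extChartAt 𝓘(ℝ, EuclideanSpace ℝ (Fin n)) x₀
  obtain ⟨T, hT, hd, h2⟩ := exists_transition hφ (ψ.map_target hqt)
  have hsec := h2 O N h (by rw [ψ.right_inv hqt]; exact hq)
  rw [ψ.right_inv hqt] at hd hsec
  have hjet := h.jet hq
  have hN : IsUnitNormalVector ε φ (ψ.symm q) (N q) :=
    ⟨hjet.base_normal, fun X => by rw [hd, form_comm, hjet.normal], hjet.unit⟩
  obtain ⟨l, hl⟩ := hum _ _ hN
  obtain ⟨X₁, Y₁, h1⟩ := hnf _ _ hN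
  refine ⟨l, fun h0 => h1 (by rw [hl, h0, zero_mul]), fun X => ?_⟩
  rw [← sub_eq_zero, sub_neg_eq_add]
  refine hjet.eq_zero hε ?_ ?_ fun Y => ?_
  · rw [form_add_right, form_smul_right, hjet.base_shape, hjet.tangent, mul_zero, add_zero]
  · rw [form_add_right, form_smul_right, hjet.normal_shape, hjet.normal, mul_zero, add_zero]
  · obtain ⟨X', rfl⟩ := hT.surjective X
    obtain ⟨Y', rfl⟩ := hT.surjective Y
    have h3 := hl X' Y'
    rw [hsec, firstForm, hd, hd] at h3
    rw [form_comm, form_add_left, form_smul_left]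
    refine (mul_eq_zero.mp (?_ : ε * _ = 0)).resolve_left hε0
    linear_combination -h3

/-- Near any unit tangent vector, the unit tangent bundle is parametrized by normalizing the vectors of
an affine hyperplane in each tangent space. -/
theorem exists_isUnitTangentParam (hn : 0 < n) (hε : ε = 1 ∨ ε = -1)
    (hφ : IsImmersedHypersurface ε φ) {x₀ : M}
    {O : Set (EuclideanSpace ℝ (Fin n))} {N : EuclideanSpace ℝ (Fin n) → Amb n}
    (h : LocalHypersurface ε O (localRep φ x₀) N)
    (hOt : O ⊆ (extChartAt 𝓘(ℝ, EuclideanSpace ℝ (Fin n)) x₀).target)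
    {v₀ : Amb n} (hv₀ : IsUnitTangent ε φ x₀ v₀) :
    ∃ (q : Par n → EuclideanSpace ℝ (Fin n)) (v : Par n → Amb n) (u₀ : Par n),
      ContDiff ℝ ∞ q ∧ q u₀ = extChartAt 𝓘(ℝ, EuclideanSpace ℝ (Fin n)) x₀ x₀ ∧ v u₀ = v₀ ∧
      IsUnitTangentParam ε φ (q ⁻¹' O)
        (fun u => (extChartAt 𝓘(ℝ, EuclideanSpace ℝ (Fin n)) x₀).symm (q u)) v := by
  have hs := curvature_mul_self hε
  set ψ := extChartAt 𝓘(ℝ, EuclideanSpace ℝ (Fin n)) x₀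
  set Φ := localRep φ x₀
  obtain ⟨hv₀r, hv₀u⟩ := hv₀
  rw [range_dphi hφ (mem_extChartAt_source x₀)] at hv₀r
  obtain ⟨ζ, hζ⟩ := hv₀r
  let ℓ : EuclideanSpace ℝ (Fin n) →L[ℝ] ℝ := ε • (formL n ε v₀).comp (fderiv ℝ Φ (ψ x₀))
  have hℓζ : ℓ ζ = 1 := by
    change ε * form ε v₀ (fderiv ℝ Φ (ψ x₀) ζ) = 1
    rw [hζ, hv₀u, hs]
  let K : Submodule ℝ (EuclideanSpace ℝ (Fin n)) := LinearMap.ker ℓ.toLinearMap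
  have hK : Module.finrank ℝ K = n - 1 := by
    have h1 := ℓ.toLinearMap.finrank_range_add_finrank_ker
    have h2 : LinearMap.range ℓ.toLinearMap = ⊤ := LinearMap.range_eq_top.mpr fun a =>
      ⟨a • ζ, by change ℓ (a • ζ) = a; rw [map_smul, hℓζ, smul_eq_mul, mul_one]⟩
    rw [h2, finrank_top, Module.finrank_self, finrank_euclideanSpace, Fintype.card_fin] at h1
    change Module.finrank ℝ (LinearMap.ker ℓ.toLinearMap) = n - 1
    omega
  let θ : Par n ≃L[ℝ] EuclideanSpace ℝ (Fin n) × K := ContinuousLinearEquiv.ofFinrankEq (by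
    rw [Module.finrank_prod, hK, finrank_euclideanSpace, finrank_euclideanSpace, Fintype.card_fin,
      Fintype.card_fin]
    omega)
  let qL : Par n →L[ℝ] EuclideanSpace ℝ (Fin n) :=
    (ContinuousLinearMap.fst ℝ _ K).comp θ.toContinuousLinearMap
  let rL : Par n →L[ℝ] EuclideanSpace ℝ (Fin n) :=
    (K.subtypeL.comp (ContinuousLinearMap.snd ℝ _ K)).comp θ.toContinuousLinearMap
  have hℓr : ∀ u, ℓ (rL u) = 0 := fun u => (θ u).2.2
  have hθ : ∀ u, qL u = 0 → rL u = 0 → u = 0 := fun u h1 h2 =>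
    θ.injective (by
      rw [map_zero]
      exact Prod.ext h1 (Subtype.ext h2))
  let y : Par n → Amb n := fun u => fderiv ℝ Φ (qL u) (ζ + rL u)
  let σ : Par n → ℝ := fun u => (√(ε * form ε (y u) (y u)))⁻¹
  have hUo : IsOpen (qL ⁻¹' O) := h.isOpen.preimage qL.continuous
  have hpos : ∀ u ∈ qL ⁻¹' O, 0 < ε * form ε (y u) (y u) := fun u hu => by
    refine form_self_pos hε (h.mem _ hu).1 ((h.jet hu).tangent _) fun h0 => ?_
    have h1 : ζ + rL u = 0 := h.inj _ hu (by rw [map_zero]; exact h0)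
    have h2 := congrArg ℓ h1
    rw [map_add, hℓζ, hℓr, map_zero, add_zero] at h2
    exact one_ne_zero h2
  have hdΦ : ContDiffOn ℝ ∞ (fun u => fderiv ℝ Φ (qL u)) (qL ⁻¹' O) :=
    (h.smooth.fderiv_of_isOpen h.isOpen (by simp)).comp qL.contDiff.contDiffOn fun _ hu => hu
  have hy : ContDiffOn ℝ ∞ y (qL ⁻¹' O) :=
    hdΦ.clm_apply (contDiff_const.add rL.contDiff).contDiffOn
  have hvs : ContDiffOn ℝ ∞ (fun u => normalized ε (y u)) (qL ⁻¹' O) :=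
    contDiffOn_normalized hy hpos
  have hσ0 : ∀ u ∈ qL ⁻¹' O, σ u ≠ 0 := fun u hu =>
    inv_ne_zero (Real.sqrt_pos.mpr (hpos u hu)).ne'
  have hσs : ContDiffOn ℝ ∞ σ (qL ⁻¹' O) :=
    ((contDiffOn_const.mul (contDiffOn_form hy hy)).sqrt fun w hw => (hpos w hw).ne').inv
      fun w hw => (Real.sqrt_pos.mpr (hpos w hw)).ne'
  have hu₀ : θ (θ.symm (ψ x₀, 0)) = (ψ x₀, 0) := θ.apply_symm_apply _
  have hqu₀ : qL (θ.symm (ψ x₀, 0)) = ψ x₀ := congrArg Prod.fst hu₀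
  have hru₀ : rL (θ.symm (ψ x₀, 0)) = 0 := congrArg (fun z => (z.2 : EuclideanSpace ℝ (Fin n))) hu₀
  refine ⟨qL, fun u => normalized ε (y u), θ.symm (ψ x₀, 0), qL.contDiff, hqu₀, ?_, hUo, ?_, hvs,
    fun u hu => ⟨?_, form_normalized hε (hpos u hu)⟩, fun u hu => ?_⟩
  · have h1 : y (θ.symm (ψ x₀, 0)) = v₀ := by
      change fderiv ℝ Φ (qL _) (ζ + rL _) = v₀
      rw [hqu₀, hru₀, add_zero, hζ]
    beta_reduce
    rw [h1, normalized, hv₀u, hs, Real.sqrt_one, inv_one, one_smul]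
  · exact (contMDiffOn_extChartAt_symm x₀).comp qL.contDiff.contMDiff.contMDiffOn
      fun u hu => hOt hu
  · rw [range_dphi hφ (ψ.map_target (hOt hu)), ψ.right_inv (hOt hu)]
    exact ⟨σ u • (ζ + rL u), by rw [map_smul]; rfl⟩
  · have hnh := hUo.mem_nhds hu
    have hdσ := ((hσs.contDiffAt hnh).differentiableAt (by simp)).hasFDerivAt
    have hdA : HasFDerivAt (fun w => fderiv ℝ Φ (qL w)) _ u :=
      HasFDerivAt.comp u (((h.smooth.fderiv_of_isOpen h.isOpen (m := ∞) (by simp)).contDiffAt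
        (h.isOpen.mem_nhds hu)).differentiableAt (by simp)).hasFDerivAt qL.hasFDerivAt
    have hdr : HasFDerivAt (fun w => ζ + rL w) rL u := rL.hasFDerivAt.const_add ζ
    have hdy : HasFDerivAt y _ u := hdA.clm_apply hdr
    have hdv : HasFDerivAt (fun u => normalized ε (y u)) _ u := hdσ.smul hdy
    have hdΦq : HasFDerivAt (fun w => Φ (qL w)) _ u := (h.hasFDerivAt hu).comp u qL.hasFDerivAt
    have hpair : HasFDerivAt (fun w => (φ (ψ.symm (qL w)), normalized ε (y w))) _ u :=
      hdΦq.prodMk hdv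
    refine (injective_iff_map_eq_zero _).mpr fun e he => ?_
    rw [hpair.fderiv] at he
    have h1 : fderiv ℝ Φ (qL u) (qL e) = 0 := congrArg Prod.fst he
    have hqe : qL e = 0 := h.inj _ hu (by rw [h1, map_zero])
    have h2 := congrArg Prod.snd he
    simp only [ContinuousLinearMap.prod_apply, add_apply, smul_apply,
      ContinuousLinearMap.smulRight_apply, ContinuousLinearMap.comp_apply,
      ContinuousLinearMap.flip_apply, hqe, map_zero, zero_apply, add_zero, Prod.snd_zero] at h2
    -- the vertical part of the kernel is a multiple of the vector itself
    have h3 : fderiv ℝ Φ (qL u) (σ u • rL e + fderiv ℝ σ u e • (ζ + rL u)) = 0 := by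
      rw [map_add, map_smul, map_smul]; exact h2
    have h4 : σ u • rL e + fderiv ℝ σ u e • (ζ + rL u) = 0 :=
      h.inj _ hu (by rw [h3, map_zero])
    have h5 := congrArg ℓ h4
    simp only [map_add, map_smul, hℓr, hℓζ, mul_zero, zero_add, add_zero, smul_eq_mul, mul_one,
      map_zero] at h5
    rw [h5, zero_smul, add_zero] at h4
    exact hθ e hqe ((smul_eq_zero.mp h4).resolve_left (hσ0 u hu))

theorem TangentHypersurfaceIsHopf.of_umbilic_nonFlat (hn : 0 < n) (hε : ε = 1 ∨ ε = -1)
    (hφ : IsImmersedHypersurface ε φ) (hum : IsTotallyUmbilic ε φ) (hnf : IsNonFlat ε φ) :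
    TangentHypersurfaceIsHopf ε φ := by
  have hε0 : ε ≠ 0 := by rcases hε with rfl | rfl <;> norm_num
  intro x₀ v₀ hv₀
  obtain ⟨O, hOt, hO, N, h⟩ := exists_localHypersurface_localRep hε hφ x₀
  obtain ⟨q, v, u₀, hq, hqu₀, hvu₀, hc⟩ := exists_isUnitTangentParam hn hε hφ h hOt hv₀
  set ψ := extChartAt 𝓘(ℝ, EuclideanSpace ℝ (Fin n)) x₀
  have hdq : ∀ u, DifferentiableAt ℝ q u := fun u => hq.contDiffAt.differentiableAt (by simp)
  have hdv : ∀ u ∈ q ⁻¹' O, DifferentiableAt ℝ v u := fun u hu =>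
    (hc.smooth_vec.contDiffAt (hc.isOpen.mem_nhds hu)).differentiableAt (by simp)
  have hjet : ∀ u ∈ q ⁻¹' O, UnitTangentJet ε (localRep φ x₀ (q u)) (N (q u))
      (fderiv ℝ (localRep φ x₀) (q u)) (fderiv ℝ N (q u)) (v u) (fderiv ℝ q u)
      (fderiv ℝ v u) := fun u hu => by
    refine h.unitTangentJet hu (hdq u) (hdv u hu) ?_ (hc.immersion u hu)
    filter_upwards [hc.isOpen.mem_nhds hu] with w hw
    have h1 := hc.unitTangent w hw
    refine ⟨?_, h1.2⟩
    have h2 := h1.1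
    rwa [range_dphi hφ (ψ.map_target (hOt hw)), ψ.right_inv (hOt hw)] at h2
  have hF := fun u hu => h.fderiv_wedge (q := q) (v := v) (u := u) hu (hdq u) (hdv u hu)
  have hΦs : ContDiffOn ℝ ∞ (fun u => localRep φ x₀ (q u)) (q ⁻¹' O) :=
    h.smooth.comp hq.contDiffOn fun _ hu => hu
  have hνs : ContDiffOn ℝ ∞ (fun u => wedge (v u) (N (q u))) (q ⁻¹' O) :=
    contDiffOn_wedge hc.smooth_vec (h.smooth_normal.comp hq.contDiffOn fun _ hu => hu)
  refine ⟨q ⁻¹' O, _, v, hc, ⟨u₀, ?_, ?_, hvu₀⟩, contDiffOn_wedge hΦs hc.smooth_vec,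
    fun u hu => ⟨_, _, (hjet u hu).frame (h.jet hu), rfl⟩, fun u hu => ?_,
    fun u hu => ⟨q ⁻¹' O, fun u => wedge (v u) (N (q u)), hc.isOpen, hu, subset_rfl, hνs,
      fun w hw => ⟨⟨(hjet w hw).wedge_normal_mem hε (h.jet hw),
        (hjet w hw).bivForm_wedge_normal (h.jet hw) (hF w hw), Or.inl ?_⟩, ?_⟩⟩⟩
  · rw [Set.mem_preimage, hqu₀]; exact hO
  · rw [hqu₀]; exact extChartAt_to_inv x₀
  · obtain ⟨ζ, hζ⟩ := (hjet u hu).range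
    obtain ⟨l, hl, hS⟩ := exists_shape_eq hε hφ hum hnf h hu (hOt hu)
    refine ((hjet u hu).injective_iff hε (h.jet hu) (hF u hu) hζ).mpr ?_
    rw [hS, hζ, form_neg_left, form_smul_left, (hjet u hu).unit]
    exact neg_ne_zero.mpr (mul_ne_zero hl hε0)
  · obtain ⟨ζ, hζ⟩ := (hjet w hw).range
    rw [bivForm_wedge, (hjet w hw).unit, h.unit _ hw, form_comm (v w), ← hζ, h.normal _ hw,
      curvature_mul_self hε, zero_mul, sub_zero]
  · obtain ⟨l, hl, hS⟩ := exists_shape_eq hε hφ hum hnf h hw (hOt hw)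
    exact (hjet w hw).exists_principal hε (h.jet hw) (hF w hw) hl hS
      (wedge_hasFDerivAt (hdv w hw).hasFDerivAt
        ((h.hasFDerivAt_normal hw).comp w (hdq w).hasFDerivAt)).2

end Backward

end

theorem theorem1 (n : ℕ) (hn : 2 ≤ n) (ε : ℝ) (hε : ε = 1 ∨ ε = -1)
    {M : Type*} [TopologicalSpace M] [ChartedSpace (EuclideanSpace ℝ (Fin n)) M]
    [IsManifold 𝓘(ℝ, EuclideanSpace ℝ (Fin n)) ∞ M]
    (φ : M → Amb n) (hφ : IsImmersedHypersurface ε φ) :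
    TangentHypersurfaceIsHopf ε φ ↔ IsTotallyUmbilic ε φ ∧ IsNonFlat ε φ :=
  ⟨fun hH => hH.umbilic_nonFlat (by omega) hε hφ,
    fun h => .of_umbilic_nonFlat (by omega) hε hφ h.1 h.2⟩
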